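/- Let $m,q,p$ be positive integers, and let all spaces $\mathbb{R}^d$ and their products carry the Euclidean inner product and norm. Let $F\colon\mathbb{R}^p\to\mathbb{R}\cup\{+\infty\}$ and $G\colon\mathbb{R}^q\to\mathbb{R}\cup\{+\infty\}$ be proper, lower semicontinuous and bounded from below, let $H\colon\mathbb{R}^m\times\mathbb{R}^q\to\mathbb{R}$ be continuously differentiable and bounded from below, and let $A\colon\mathbb{R}^m\to\mathbb{R}^p$ be linear and surjective. Let $\lambda:=\lambda_{\min}(AA^T)>0$ be the smallest eigenvalue of $AA^T$. Let $\mu,\beta,\tau>0$ and $0<\sigma\le 1$, and let $(x_n,y_n,z_n,u_n)_{n\ge 0}$ in $\mathbb{R}^m\times\mathbb{R}^q\times\mathbb{R}^p\times\mathbb{R}^p$ be a bounded sequence such that, for all $n\ge 0$, $$y_{n+1}\in\arg\min_{y}\Big\{G(y)+\langle\nabla_yH(x_n,y_n),y\rangle+\tfrac{\mu}{2}\|y-y_n\|^2\Big\},$$ $$z_{n+1}\in\arg\min_{z}\Big\{F(z)+\langle u_n,Ax_n-z\rangle+\tfrac{\beta}{2}\|Ax_n-z\|^2\Big\},$$ $$x_{n+1}=x_n-\tau^{-1}\big(\nabla_xH(x_n,y_{n+1})+A^Tu_n+\beta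 A^T(Ax_n-z_{n+1})\big),$$ $$u_{n+1}=u_n+\sigma\beta(Ax_{n+1}-z_{n+1}),$$ with arbitrary starting point $(x_0,y_0,z_0,u_0)$. Let $L>0$ and let $B_1\subseteq\mathbb{R}^m$, $B_2\subseteq\mathbb{R}^q$ be bounded convex sets such that $(x_n,y_n)\in B_1\times B_2$ for all $n$ and $\nabla H$ is Lipschitz continuous with constant $L$ on $B_1\times B_2$. Assume that $2\tau\ge\beta\|A\|^2$ and $\min\{C_2,C_3,C_4\}>0$, where $$C_2:=\tau-\frac{L\sqrt2+\beta\|A\|^2}{2}-\frac{4\sigma\tau^2}{\beta\lambda}-\frac{8(\sigma\tau+L\sqrt2)^2}{\sigma\beta\lambda},\quad C_3:=\frac{\mu-L\sqrt2}{2}-\frac{16L^2}{\sigma\beta\lambda},\quad C_4:=\frac1{\sigma\beta}.$$ With $B:=\tau\,\mathrm{Id}-\beta A^TA$, $C_0:=\frac{4(1-\sigma)}{\sigma^2\beta\lambda}$ and $C_1:=\frac{8(\sigma\tau+L\sqrt2)^2}{\sigma\beta\lambda}$, define the regularized augmented Lagrangian $\Psi\colon\mathbb{R}^m\times\mathbb{R}^q\times\mathbb{R}^p\times\mathbb{R}^p\times\mathbb{R}^m\times\mathbb{R}^p\to\mathbb{R}\cup\{+\infty\}$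 by $$\Psi(x,y,z,u,x',u'):=F(z)+G(y)+H(x,y)+\langle u,Ax-z\rangle+\tfrac{\beta}{2}\|Ax-z\|^2+C_0\|A^T(u-u')+\sigma B(x-x')\|^2+C_1\|x-x'\|^2.$$ Let $\partial\psi$ denote the limiting (Mordukhovich) subdifferential of a function $\psi$: $d\in\partial\psi(x)$ iff $\psi(x)<+\infty$ and there are $x_k\to x$, $d_k\to d$ with $\psi(x_k)\to\psi(x)$ and $d_k\in\widehat\partial\psi(x_k)$ for all $k$, where $d\in\widehat\partial\psi(x)$ iff $\psi(x)<+\infty$ and $\liminf_{y\to x,\,y\ne x}\frac{\psi(y)-\psi(x)-\langle d,y-x\rangle}{\|y-x\|}\ge 0$. Assume that $\Psi$ is a Kurdyka--Łojasiewicz function, i.e. for each $w$ with $\partial\Psi(w)\ne\emptyset$ there are $\eta\in(0,+\infty]$, a neighborhood $U$ of $w$ and a concave continuous $\varphi\colon[0,\eta)\to[0,+\infty)$ with $\varphi(0)=0$, $\varphi$ being $C^1$ on $(0,\eta)$ and $\varphi'>0$ on $(0,\eta)$, such that $$\varphi'\big(\Psi(v)-\Psi(w)\big)\cdot\mathrm{dist}\big(0,\partial\Psi(v)\big)\ge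 1\quad\text{for all }v\in U\text{ with }\Psi(w)<\Psi(v)<\Psi(w)+\eta$$ (where $\mathrm{dist}(0,\emptyset)=+\infty$). Then: 1. the sequence has finite length: $\sum_{n\ge0}\|x_{n+1}-x_n\|<+\infty$, $\sum_{n\ge0}\|y_{n+1}-y_n\|<+\infty$, $\sum_{n\ge0}\|z_{n+1}-z_n\|<+\infty$ and $\sum_{n\ge0}\|u_{n+1}-u_n\|<+\infty$; 2. the sequence $(x_n,y_n,z_n,u_n)$ converges to a KKT point of $\min_{x,y}\{F(Ax)+G(y)+H(x,y)\}$, that is, to some $(x_*,y_*,z_*,u_*)$ with $-A^Tu_*=\nabla_xH(x_*,y_*)$, $0\in\partial G(y_*)+\nabla_yH(x_*,y_*)$, $u_*\in\partial F(z_*)$ and $z_*=Ax_*$. -/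

import Mathlib

open Filter Topology Set

noncomputable section

namespace FullSplitting

/-- The Euclidean space `ℝ^d`. -/
abbrev E (d : ℕ) : Type := EuclideanSpace ℝ (Fin d)

/-! ### Extended-real-valued functions and subdifferentials

Functions with values in `ℝ ∪ {+∞}` are modelled as `EReal`-valued functions that never take the
value `⊥`. -/

section Subdifferential

variable {V : Type*} [NormedAddCommGroup V] [InnerProductSpace ℝ V]

/-- Properness: the value `-∞` is never attained and the effective domain is nonempty. -/
def IsProper (ψ : V → EReal) : Prop :=
  (∀ x, ψ x ≠ ⊥) ∧ ∃ x, ψ x ≠ ⊤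

/-- Boundedness from below by a real number. -/
def IsBoundedBelow (ψ : V → EReal) : Prop :=
  ∃ c : ℝ, ∀ x, (c : EReal) ≤ ψ x

/-- The Fréchet (viscosity) subdifferential of `ψ` at `x`: empty outside the effective domain,
and otherwise the set of all `d` such that
`liminf_{y → x, y ≠ x} (ψ y - ψ x - ⟪d, y - x⟫) / ‖y - x‖ ≥ 0`. -/
def frechetSubdiff (ψ : V → EReal) (x : V) : Set V :=
  {d | ψ x ≠ ⊤ ∧
    0 ≤ liminf (fun y : V =>
      (ψ y - ψ x - ((inner ℝ d (y - x) : ℝ) : EReal)) / ((‖y - x‖ : ℝ) : EReal)) (𝓝[≠] x)}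

/-- The limiting (Mordukhovich) subdifferential of `ψ` at `x`, empty outside the effective
domain. -/
def limitingSubdiff (ψ : V → EReal) (x : V) : Set V :=
  {d | ψ x ≠ ⊤ ∧ ∃ (xs ds : ℕ → V),
    Tendsto xs atTop (𝓝 x) ∧ Tendsto ds atTop (𝓝 d) ∧
    Tendsto (fun n => ψ (xs n)) atTop (𝓝 (ψ x)) ∧
    ∀ n, ds n ∈ frechetSubdiff ψ (xs n)}

/-- The desingularization functions on `[0, η)`, where `0 < η ≤ +∞`: concave, continuous and
nonnegative on `[0, η)`, vanishing at `0`, and `C¹` with positive derivative on `(0, η)`. Only the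
values of `φ` on `[0, η)` matter. -/
structure IsDesingularizing (η : EReal) (φ : ℝ → ℝ) : Prop where
  concave : ConcaveOn ℝ {s : ℝ | 0 ≤ s ∧ (s : EReal) < η} φ
  continuousOn : ContinuousOn φ {s : ℝ | 0 ≤ s ∧ (s : EReal) < η}
  nonneg : ∀ s : ℝ, 0 ≤ s → (s : EReal) < η → 0 ≤ φ s
  map_zero : φ 0 = 0
  contDiffOn : ContDiffOn ℝ 1 φ {s : ℝ | 0 < s ∧ (s : EReal) < η}
  deriv_pos : ∀ s : ℝ, 0 < s → (s : EReal) < η → 0 < deriv φ s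

/-- The Kurdyka–Łojasiewicz property of `Ψ` at `w`. The distance of `0` to `∂Ψ(v)` is the
extended one, so that it is `+∞` when `∂Ψ(v)` is empty. -/
def HasKLPropertyAt (Ψ : V → EReal) (w : V) : Prop :=
  ∃ η : EReal, 0 < η ∧ ∃ U ∈ 𝓝 w, ∃ φ : ℝ → ℝ, IsDesingularizing η φ ∧
    ∀ v ∈ U, Ψ w < Ψ v → Ψ v < Ψ w + η →
      1 ≤ ENNReal.ofReal (deriv φ ((Ψ v).toReal - (Ψ w).toReal)) *
        Metric.infEDist (0 : V) (limitingSubdiff Ψ v)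

/-- `Ψ` is a KŁ function: it has the KŁ property at each point where `∂Ψ` is nonempty. -/
def IsKLFunction (Ψ : V → EReal) : Prop :=
  ∀ w : V, (limitingSubdiff Ψ w).Nonempty → HasKLPropertyAt Ψ w

end Subdifferential

/-! ### The problem `min F(Ax) + G(y) + H(x, y)` and the algorithm -/

section Problem

variable {m q p : ℕ}

/-- The partial gradient `∇ₓH(x, y)`. -/
def gradX (H : E m × E q → ℝ) (x : E m) (y : E q) : E m :=
  gradient (fun x' => H (x', y)) x

/-- The partial gradient `∇_y H(x, y)`. -/
def gradY (H : E m × E q → ℝ) (x : E m) (y : E q) : E q :=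
  gradient (fun y' => H (x, y')) y

/-- `∇H` is Lipschitz with constant `L` on `B₁ × B₂`, for the Euclidean norms of the products. -/
def GradLipschitzOn (H : E m × E q → ℝ) (L : ℝ) (B₁ : Set (E m)) (B₂ : Set (E q)) : Prop :=
  ∀ x ∈ B₁, ∀ y ∈ B₂, ∀ x' ∈ B₁, ∀ y' ∈ B₂,
    √(‖gradX H x y - gradX H x' y'‖ ^ 2 + ‖gradY H x y - gradY H x' y'‖ ^ 2) ≤
      L * √(‖x - x'‖ ^ 2 + ‖y - y'‖ ^ 2)

/-- The transpose `Aᵀ`. -/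
abbrev tr (A : E m →L[ℝ] E p) : E p →L[ℝ] E m := ContinuousLinearMap.adjoint A

/-- `(x_n, y_n, z_n, u_n)` is a sequence generated by the algorithm (from an arbitrary starting
point) with parameters `μ, β, τ, σ`. -/
structure IsGenerated (A : E m →L[ℝ] E p) (F : E p → EReal) (G : E q → EReal)
    (H : E m × E q → ℝ) (μ β τ σ : ℝ)
    (x : ℕ → E m) (y : ℕ → E q) (z u : ℕ → E p) : Prop where
  y_step : ∀ n, IsMinOn
    (fun v : E q => G v +
      ((inner ℝ (gradY H (x n) (y n)) v + μ / 2 * ‖v - y n‖ ^ 2 : ℝ) : EReal))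
    univ (y (n + 1))
  z_step : ∀ n, IsMinOn
    (fun w : E p => F w +
      ((inner ℝ (u n) (A (x n) - w) + β / 2 * ‖A (x n) - w‖ ^ 2 : ℝ) : EReal))
    univ (z (n + 1))
  x_step : ∀ n, x (n + 1) = x n - τ⁻¹ •
    (gradX H (x n) (y (n + 1)) + tr A (u n) + β • tr A (A (x n) - z (n + 1)))
  u_step : ∀ n, u (n + 1) = u n + (σ * β) • (A (x (n + 1)) - z (n + 1))

/-- The smallest eigenvalue `λ_min(A Aᵀ)`. -/
def lambdaMin (A : E m →L[ℝ] E p) : ℝ :=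
  sInf {r : ℝ | Module.End.HasEigenvalue ((A ∘L tr A : E p →L[ℝ] E p) : E p →ₗ[ℝ] E p) r}

/-- `B = τ Id - β AᵀA`. -/
def opB (A : E m →L[ℝ] E p) (β τ : ℝ) : E m →L[ℝ] E m :=
  τ • ContinuousLinearMap.id ℝ (E m) - β • (tr A ∘L A)

def constC0 (A : E m →L[ℝ] E p) (β σ : ℝ) : ℝ :=
  4 * (1 - σ) / (σ ^ 2 * β * lambdaMin A)

def constC1 (A : E m →L[ℝ] E p) (β τ σ L : ℝ) : ℝ :=
  8 * (σ * τ + L * √2) ^ 2 / (σ * β * lambdaMin A)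

def constC2 (A : E m →L[ℝ] E p) (β τ σ L : ℝ) : ℝ :=
  τ - (L * √2 + β * ‖A‖ ^ 2) / 2 - 4 * σ * τ ^ 2 / (β * lambdaMin A)
    - 8 * (σ * τ + L * √2) ^ 2 / (σ * β * lambdaMin A)

def constC3 (A : E m →L[ℝ] E p) (μ β σ L : ℝ) : ℝ :=
  (μ - L * √2) / 2 - 16 * L ^ 2 / (σ * β * lambdaMin A)

def constC4 (β σ : ℝ) : ℝ := 1 / (σ * β)

/-- The space `ℝ^m × ℝ^q × ℝ^p × ℝ^p × ℝ^m × ℝ^p` of points `(x, y, z, u, x', u')`, with the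
Euclidean inner product of the product. -/
abbrev RSpace (m q p : ℕ) : Type :=
  WithLp 2 (E m × WithLp 2 (E q × WithLp 2 (E p × WithLp 2 (E p × WithLp 2 (E m × E p)))))

/-- The regularized augmented Lagrangian as a function of its six blocks. -/
def PsiFun (A : E m →L[ℝ] E p) (F : E p → EReal) (G : E q → EReal) (H : E m × E q → ℝ)
    (β τ σ L : ℝ) (x : E m) (y : E q) (z u : E p) (x' : E m) (u' : E p) : EReal :=
  F z + G y +
    ((H (x, y) + inner ℝ u (A x - z) + β / 2 * ‖A x - z‖ ^ 2
      + constC0 A β σ * ‖tr A (u - u') + σ • opB A β τ (x - x')‖ ^ 2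
      + constC1 A β τ σ L * ‖x - x'‖ ^ 2 : ℝ) : EReal)

/-- The regularized augmented Lagrangian `Ψ(x, y, z, u, x', u')` on the product space. -/
def Psi (A : E m →L[ℝ] E p) (F : E p → EReal) (G : E q → EReal) (H : E m × E q → ℝ)
    (β τ σ L : ℝ) (X : RSpace m q p) : EReal :=
  PsiFun A F G H β τ σ L X.fst X.snd.fst X.snd.snd.fst X.snd.snd.snd.fst
    X.snd.snd.snd.snd.fst X.snd.snd.snd.snd.snd

/-- KKT points `(x, y, z, u)` of `min F(Ax) + G(y) + H(x, y)`. The second condition says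
`0 ∈ ∂G(y) + ∇_y H(x, y)`. -/
structure IsKKT (A : E m →L[ℝ] E p) (F : E p → EReal) (G : E q → EReal) (H : E m × E q → ℝ)
    (x : E m) (y : E q) (z u : E p) : Prop where
  stat_x : -(tr A u) = gradX H x y
  stat_y : ∃ d ∈ limitingSubdiff G y, 0 = d + gradY H x y
  stat_z : u ∈ limitingSubdiff F z
  feasible : z = A x

end Problem

end FullSplitting

end

open FullSplitting

/-! The `y`-, `z`- and `x`-steps decrease the augmented Lagrangian, but the multiplier update raises
it by `‖u_{n+1} - u_n‖² / (σβ)`. Surjectivity of `A` makes this increase payable, because `λ‖v‖² ≤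
‖Aᵀv‖²` (`lambdaMin_spec`). The vector `w_n = Aᵀ(u_{n+1} - u_n) + σB(x_{n+1} - x_n)` equals
`-σ(Aᵀu_n + ∇ₓH(x_n, y_{n+1}))`, hence `w_{n+1} = (1 - σ)w_n + σr_n` with `r_n` controlled by steps
in `x` and `y` (`regVec_succ`). Convexity of the square bounds the increase by a telescoping
difference of `‖w_n‖²` plus squared steps (`multiplier_le`); the `C₀` and `C₁` terms of `Ψ` absorb
these. So `Ψ` drops by a fixed multiple of the squared step length (`sufficient_decrease`), and
since it is bounded below along the sequence, the steps tend to zero.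

Each iterate carries a subgradient of `Ψ` of the order of the step length (`exists_subgradient`).
Lower semicontinuity and minimality make the values of `F` and `G` converge along subsequences
(`tendsto_of_isMinOn`), so at a cluster point `w` the values of `Ψ` converge to `Ψ(w)` and `0 ∈
∂Ψ(w)`. The Kurdyka–Łojasiewicz inequality is thus available at `w`.

Concavity of `φ` combines decrease and subgradient bound into `a_{n+1} ≤ a_n/2 + K(φ(l_n) -
φ(l_{n+1}))` for the step lengths `a_n` and the gaps `l_n` of `Ψ` to its limit (`kl_step`). This
telescopes, and it also traps the iterates near `w`, where the inequality holds (`summable_of_kl`).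
The sequence is therefore Cauchy, and the optimality conditions of the steps pass to the limit. -/

open Asymptotics

namespace FullSplitting

/-! ### Fréchet subgradients and the descent lemma -/

section General

variable {V : Type*} [NormedAddCommGroup V] [InnerProductSpace ℝ V]

/-- The derivative of a smooth minorant that touches `ψ` at `x` is a Fréchet subgradient. -/
theorem mem_frechetSubdiff_of_minorant {ψ : V → EReal} {x d : V} {T : V → ℝ}
    (hx : ψ x = (T x : EReal)) (hT : ∀ v, (T v : EReal) ≤ ψ v)
    (hd : HasFDerivAt T (innerSL ℝ d) x) : d ∈ frechetSubdiff ψ x := by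
  refine ⟨by rw [hx]; exact EReal.coe_ne_top _, ?_⟩
  have key : ∀ ε : ℝ, 0 < ε → ((-ε : ℝ) : EReal) ≤ liminf (fun y : V =>
      (ψ y - ψ x - ((inner ℝ d (y - x) : ℝ) : EReal)) / ((‖y - x‖ : ℝ) : EReal)) (𝓝[≠] x) := by
    intro ε hε
    refine le_liminf_of_le (by isBoundedDefault) ?_
    have h1 := (hasFDerivAt_iff_isLittleO.1 hd).def hε
    filter_upwards [h1.filter_mono nhdsWithin_le_nhds, self_mem_nhdsWithin] with y hy hne
    have hpos : 0 < ‖y - x‖ := norm_pos_iff.2 (sub_ne_zero.2 hne)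
    have h2 : -(ε * ‖y - x‖) ≤ T y - T x - inner ℝ d (y - x) := by
      have := (abs_le.1 ((Real.norm_eq_abs _).symm.le.trans hy)).1
      simpa using this
    rw [EReal.le_div_iff_mul_le (by exact_mod_cast hpos) (EReal.coe_ne_top _), hx,
      ← EReal.coe_mul]
    calc ((-ε * ‖y - x‖ : ℝ) : EReal)
        ≤ ((T y - T x - inner ℝ d (y - x) : ℝ) : EReal) := by
          rw [EReal.coe_le_coe_iff]; linarith
      _ = (T y : EReal) - (T x : EReal) - ((inner ℝ d (y - x) : ℝ) : EReal) := by
          push_cast; rfl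
      _ ≤ _ := EReal.sub_le_sub (EReal.sub_le_sub (hT y) le_rfl) le_rfl
  refine le_of_forall_lt fun c hc => ?_
  obtain ⟨r, hcr, hr⟩ := EReal.lt_iff_exists_real_btwn.1 hc
  have hr' : r < 0 := by exact_mod_cast hr
  refine hcr.trans_le ?_
  have := key (-r) (by linarith)
  simpa using this

theorem frechetSubdiff_subset_limitingSubdiff (ψ : V → EReal) (x : V) :
    frechetSubdiff ψ x ⊆ limitingSubdiff ψ x := fun d hd =>
  ⟨hd.1, fun _ => x, fun _ => d, tendsto_const_nhds, tendsto_const_nhds, tendsto_const_nhds,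
    fun _ => hd⟩

/-- The descent lemma along a segment. -/
theorem descent_segment {f : V → ℝ} {g : V → V} {a d : V} {L : ℝ}
    (hf : ∀ v, HasFDerivAt f (innerSL ℝ (g v)) v)
    (hL : ∀ t ∈ Icc (0 : ℝ) 1, ‖g (a + t • d) - g a‖ ≤ L * (t * ‖d‖)) :
    f (a + d) ≤ f a + inner ℝ (g a) d + L / 2 * ‖d‖ ^ 2 := by
  -- `k` is `f` on the segment minus its quadratic upper model, up to a constant; the Lipschitz
  -- bound makes its derivative nonpositive.
  let k : ℝ → ℝ := fun t => f (a + t • d) - t * inner ℝ (g a) d - L / 2 * ‖d‖ ^ 2 * t ^ 2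
  have hk : ∀ t, HasDerivAt k
      (inner ℝ (g (a + t • d)) d - inner ℝ (g a) d - L * ‖d‖ ^ 2 * t) t := by
    intro t
    have h1 : HasDerivAt (fun t : ℝ => a + t • d) d t := by
      simpa using ((hasDerivAt_id t).smul_const d).const_add a
    have h2 := (hf (a + t • d)).comp_hasDerivAt t h1
    have h3 := (h2.sub ((hasDerivAt_id t).mul_const (inner ℝ (g a) d))).sub
      (((hasDerivAt_id t).pow 2).const_mul (L / 2 * ‖d‖ ^ 2))
    refine h3.congr_deriv ?_
    simp
    ring
  have hanti : AntitoneOn k (Icc 0 1) := by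
    refine antitoneOn_of_deriv_nonpos (convex_Icc 0 1)
      (fun t _ => (hk t).continuousAt.continuousWithinAt)
      (fun t _ => (hk t).differentiableAt.differentiableWithinAt) fun t ht => ?_
    have ht' : t ∈ Icc (0 : ℝ) 1 := interior_subset ht
    rw [(hk t).deriv, ← inner_sub_left]
    have h4 := real_inner_le_norm (g (a + t • d) - g a) d
    have h5 := mul_le_mul_of_nonneg_right (hL t ht') (norm_nonneg d)
    nlinarith
  have := hanti (left_mem_Icc.2 zero_le_one) (right_mem_Icc.2 zero_le_one) zero_le_one
  simp only [k, one_smul, zero_smul, add_zero] at this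
  linarith

end General

/-! ### The abstract Kurdyka–Łojasiewicz argument -/

/-- The scalar inequality behind the Kurdyka–Łojasiewicz argument. -/
theorem kl_step {η : EReal} {φ : ℝ → ℝ} (hφ : IsDesingularizing η φ) {c C a a' l l' : ℝ}
    (hc : 0 < c) (hC : 0 ≤ C) (ha : 0 ≤ a) (hl' : 0 ≤ l')
    (hlη : (l : EReal) < η) (hdec : l' + c * a' ^ 2 ≤ l)
    (hkl : 0 < l → 1 ≤ deriv φ l * (C * a)) :
    a' ≤ a / 2 + C / (2 * c) * (φ l - φ l') := by
  have hl : l' ≤ l := by nlinarith [mul_nonneg hc.le (sq_nonneg a')]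
  rcases (hl'.trans hl).eq_or_lt with h0 | hpos
  -- At `l = 0` no Kurdyka–Łojasiewicz inequality is available, but the decrease then forces `a' =
  -- 0`. This also covers sequences that reach the limit value in finitely many steps.
  · have h1 : l' = l := by linarith
    have h2 : a' = 0 := by
      have : c * a' ^ 2 ≤ 0 := by linarith
      have : a' ^ 2 ≤ 0 := by nlinarith
      nlinarith [pow_eq_zero_iff (two_ne_zero) |>.1 (le_antisymm this (sq_nonneg a'))]
    rw [h1, h2]
    simp [ha, div_nonneg]
  have hD := hφ.deriv_pos l hpos hlη
  have hk := hkl hpos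
  -- Concavity: the derivative at the right endpoint is at most the slope over `[l', l]`, even when
  -- `l' = 0`.
  have hslope : deriv φ l * (l - l') ≤ φ l - φ l' := by
    rcases hl.eq_or_lt with h | h
    · simp [h]
    · have h3 := hφ.concave.deriv_le_slope (x := l') (y := l)
        ⟨hl', lt_of_le_of_lt (by exact_mod_cast hl) hlη⟩ ⟨hpos.le, hlη⟩ h
        (differentiableAt_of_deriv_ne_zero hD.ne')
      rwa [slope_def_field, le_div_iff₀ (by linarith)] at h3
  have hCa : 0 ≤ C * a := mul_nonneg hC ha
  have hx : deriv φ l * (c * a' ^ 2) ≤ φ l - φ l' :=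
    (mul_le_mul_of_nonneg_left (by linarith) hD.le).trans hslope
  have hΔ : 0 ≤ φ l - φ l' :=
    (mul_nonneg hD.le (mul_nonneg hc.le (sq_nonneg a'))).trans hx
  have hy : c * a' ^ 2 ≤ C * a * (φ l - φ l') :=
    calc c * a' ^ 2 ≤ (deriv φ l * (C * a)) * (c * a' ^ 2) :=
          le_mul_of_one_le_left (mul_nonneg hc.le (sq_nonneg a')) hk
      _ = (C * a) * (deriv φ l * (c * a' ^ 2)) := by ring
      _ ≤ _ := mul_le_mul_of_nonneg_left hx hCa
  set δ := C / (2 * c) * (φ l - φ l') with hδ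
  have hδ0 : 0 ≤ δ := by positivity
  -- Arithmetic-geometric mean: `2aδ ≤ (a/2 + δ)²`. The weight `1/2` on `a` is what lets the
  -- recursion sum.
  have h6 : a' ^ 2 ≤ 2 * a * δ := by
    have : c * (2 * a * δ) = C * a * (φ l - φ l') := by rw [hδ]; field_simp
    nlinarith
  exact (abs_le_of_sq_le_sq' (by nlinarith [sq_nonneg (a / 2 - δ)]) (by positivity)).2

/-- Finite length of a descent sequence near a cluster point at which a Kurdyka–Łojasiewicz
inequality holds. -/
theorem summable_of_kl {V : Type*} [NormedAddCommGroup V] {X : ℕ → V} {a l : ℕ → ℝ} {w : V}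
    {η : EReal} {φ : ℝ → ℝ} {U : Set V} {c C D : ℝ}
    (hc : 0 < c) (hC : 0 ≤ C) (hD : 0 ≤ D) (ha : ∀ n, 0 ≤ a n) (ha0 : Tendsto a atTop (𝓝 0))
    (hl : ∀ n, 0 ≤ l n) (hl0 : Tendsto l atTop (𝓝 0))
    (hdec : ∀ n, l (n + 1) + c * a (n + 1) ^ 2 ≤ l n)
    (hstep : ∀ n, ‖X (n + 1) - X n‖ ≤ D * (a (n + 1) + a n))
    (hw : ∃ s : ℕ → ℕ, StrictMono s ∧ Tendsto (X ∘ s) atTop (𝓝 w))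
    (hη : 0 < η) (hU : U ∈ 𝓝 w) (hφ : IsDesingularizing η φ)
    (hkl : ∀ n, X n ∈ U → 0 < l n → (l n : EReal) < η → 1 ≤ deriv φ (l n) * (C * a n)) :
    Summable a := by
  obtain ⟨ρ, hρ, hball⟩ := Metric.mem_nhds_iff.1 hU
  obtain ⟨s, hs, hXs⟩ := hw
  have hlη : ∀ᶠ n in atTop, (l n : EReal) < η :=
    ((continuous_coe_real_ereal.tendsto 0).comp hl0).eventually (gt_mem_nhds (by simpa using hη))
  have hφl : Tendsto (fun n => φ (l n)) atTop (𝓝 0) := by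
    have h0 : ContinuousWithinAt φ {s : ℝ | 0 ≤ s ∧ (s : EReal) < η} 0 :=
      hφ.continuousOn 0 ⟨le_rfl, by simpa using hη⟩
    have := h0.tendsto.comp (tendsto_nhdsWithin_iff.2 ⟨hl0, hlη.mono fun n hn => ⟨hl n, hn⟩⟩)
    rwa [hφ.map_zero] at this
  obtain ⟨N₁, hN₁⟩ := eventually_atTop.1 hlη
  set K := C / (2 * c) with hK
  have hK0 : 0 ≤ K := by positivity
  -- a starting index from which the sequence stays in the ball
  have hbase : Tendsto (fun n => ‖X (s n) - w‖ + D * (3 * a (s n) + 4 * (K * φ (l (s n)))))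
      atTop (𝓝 0) := by
    have h1 : Tendsto (fun n => ‖X (s n) - w‖) atTop (𝓝 0) :=
      tendsto_iff_norm_sub_tendsto_zero.1 hXs
    have h2 := ha0.comp hs.tendsto_atTop
    have h3 := hφl.comp hs.tendsto_atTop
    simpa using h1.add (((h2.const_mul 3).add ((h3.const_mul K).const_mul 4)).const_mul D)
  obtain ⟨k, hk, hkN⟩ := ((hbase.eventually (gt_mem_nhds hρ)).and
    (hs.tendsto_atTop.eventually (eventually_ge_atTop N₁))).exists
  set N := s k
  have hφ0 : ∀ n, N ≤ n → 0 ≤ φ (l n) := fun n hn =>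
    hφ.nonneg _ (hl n) (hN₁ n (hkN.trans hn))
  have hone : ∀ n, N ≤ n → X n ∈ U →
      a (n + 1) ≤ a n / 2 + K * (φ (l n) - φ (l (n + 1))) := fun n hn hX =>
    kl_step hφ hc hC (ha n) (hl _) (hN₁ n (hkN.trans hn)) (hdec n)
      fun hp => hkl n hX hp (hN₁ n (hkN.trans hn))
  -- The induction must be joint: the length bound needs the iterate in `U` to use the inequality,
  -- and staying in `U` needs the length bound. The terms `a (N + j)` carried on the left-hand sides
  -- absorb the half step of `hone` and the two-term bound `hstep`.
  have htrap : ∀ j, (∑ i ∈ Finset.range j, a (N + i + 1)) + a (N + j) + 2 * K * φ (l (N + j)) ≤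
      a N + 2 * K * φ (l N) ∧
      ‖X (N + j) - w‖ + D * a (N + j) ≤ ‖X N - w‖ + D * (2 * (∑ i ∈ Finset.range j, a (N + i + 1)) + a N)
      ∧ X (N + j) ∈ U := by
    intro j
    induction j with
    | zero =>
      have h1 : ‖X N - w‖ < ρ := by
        have := mul_nonneg hD (add_nonneg (mul_nonneg zero_le_three (ha N))
          (mul_nonneg zero_le_four (mul_nonneg hK0 (hφ0 N le_rfl))))
        linarith
      exact ⟨by simp, by simp,
        hball (mem_ball_iff_norm.2 h1)⟩
    | succ j ih =>
      obtain ⟨h1, h2, h3⟩ := ih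
      have h4 := hone (N + j) (by omega) h3
      have h5 := hφ0 (N + (j + 1)) (by omega)
      have h5' := hφ0 N le_rfl
      have hsum : (∑ i ∈ Finset.range (j + 1), a (N + i + 1)) + a (N + (j + 1)) +
          2 * K * φ (l (N + (j + 1))) ≤ a N + 2 * K * φ (l N) := by
        rw [Finset.sum_range_succ, ← add_assoc N j 1]
        linarith
      have h6 : ‖X (N + (j + 1)) - w‖ + D * a (N + (j + 1)) ≤
          ‖X N - w‖ + D * (2 * (∑ i ∈ Finset.range (j + 1), a (N + i + 1)) + a N) := by
        have h7 := norm_add_le (X (N + j + 1) - X (N + j)) (X (N + j) - w)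
        rw [sub_add_sub_cancel] at h7
        have h8 := hstep (N + j)
        rw [Finset.sum_range_succ, ← add_assoc N j 1]
        linarith
      refine ⟨hsum, h6, hball ?_⟩
      rw [mem_ball_iff_norm]
      refine lt_of_le_of_lt ?_ hk
      have h7 := ha (N + (j + 1))
      have h8 : 0 ≤ 2 * K * φ (l (N + (j + 1))) := by positivity
      have h9 : 2 * (∑ i ∈ Finset.range (j + 1), a (N + i + 1)) + a N ≤
          3 * a N + 4 * (K * φ (l N)) := by linarith
      have := mul_le_mul_of_nonneg_left h9 hD
      have := mul_nonneg hD h7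
      linarith
  have hS : Summable fun i => a (N + i + 1) := by
    refine summable_of_sum_range_le (fun _ => ha _) (c := a N + 2 * K * φ (l N)) fun j => ?_
    have := (htrap j).1
    have h2 := ha (N + j)
    have h3 := mul_nonneg (mul_nonneg zero_le_two hK0) (hφ0 (N + j) (by omega))
    linarith
  rw [← summable_nat_add_iff (N + 1)]
  exact hS.congr fun i => by rw [add_comm N i, add_assoc]

end FullSplitting

/-! ### The operators `AAᵀ` and `B` -/

namespace FullSplitting

variable {m q p : ℕ}

theorem inner_tr_left (A : E m →L[ℝ] E p) (u : E p) (v : E m) :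
    inner ℝ (tr A u) v = inner ℝ u (A v) :=
  ContinuousLinearMap.adjoint_inner_left A v u

theorem inner_tr_right (A : E m →L[ℝ] E p) (u : E p) (v : E m) :
    inner ℝ v (tr A u) = inner ℝ (A v) u :=
  ContinuousLinearMap.adjoint_inner_right A v u

/-- `λ_min(AAᵀ)` is positive for surjective `A`, and bounds `AAᵀ` from below. -/
theorem lambdaMin_spec (hp : 0 < p) (A : E m →L[ℝ] E p) (hA : Function.Surjective A) :
    0 < lambdaMin A ∧ ∀ v, lambdaMin A * ‖v‖ ^ 2 ≤ ‖tr A v‖ ^ 2 := by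
  have : Nonempty (Fin p) := ⟨⟨0, hp⟩⟩
  set T : E p →ₗ[ℝ] E p := ((A ∘L tr A : E p →L[ℝ] E p) : E p →ₗ[ℝ] E p) with hT
  have hin : ∀ v w, inner ℝ (T v) w = inner ℝ (tr A v) (tr A w) := fun v w => by
    rw [inner_tr_right]; rfl
  have hsymm : T.IsSymmetric := fun v w => by
    rw [hin, ← real_inner_comm, ← hin, real_inner_comm]
  have hinj : ∀ v, tr A v = 0 → v = 0 := fun v hv => by
    obtain ⟨w, rfl⟩ := hA v
    have := inner_tr_left A (A w) w
    rw [hv, inner_zero_left] at this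
    exact inner_self_eq_zero.1 this.symm
  have hpos : ∀ r : ℝ, Module.End.HasEigenvalue T r → 0 < r := fun r hr => by
    obtain ⟨v, hv⟩ := hr.exists_hasEigenvector
    have h1 := hin v v
    rw [hv.apply_eq_smul, real_inner_smul_left, real_inner_self_eq_norm_sq,
      real_inner_self_eq_norm_sq] at h1
    have h2 : 0 < ‖tr A v‖ := norm_pos_iff.2 fun h => hv.2 (hinj v h)
    by_contra hneg
    nlinarith [sq_nonneg ‖v‖, pow_pos h2 2]
  -- In finite dimension the infimum of the Rayleigh quotient of a symmetric operator is an
  -- eigenvalue; being below every other eigenvalue, it is `lambdaMin A`.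
  have hray := hsymm.hasEigenvalue_iInf_of_finiteDimensional
  have hq : ∀ v : E p, RCLike.re (inner ℝ (T v) v) / ‖v‖ ^ 2 = ‖tr A v‖ ^ 2 / ‖v‖ ^ 2 := fun v => by
    rw [hin, real_inner_self_eq_norm_sq]; simp
  simp only [hq] at hray
  rw [RCLike.ofReal_real_eq_id, id_eq] at hray
  set ρ : ℝ := ⨅ v : { v : E p // v ≠ 0 }, ‖tr A v‖ ^ 2 / ‖(v : E p)‖ ^ 2 with hρ
  have hρle : ∀ v, ρ * ‖v‖ ^ 2 ≤ ‖tr A v‖ ^ 2 := fun v => by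
    rcases eq_or_ne v 0 with rfl | hv
    · simp
    have h1 : ρ ≤ ‖tr A v‖ ^ 2 / ‖v‖ ^ 2 := ciInf_le
      (f := fun v : { v : E p // v ≠ 0 } => ‖tr A v‖ ^ 2 / ‖(v : E p)‖ ^ 2)
      ⟨0, by rintro _ ⟨v, rfl⟩; positivity⟩ ⟨v, hv⟩
    rwa [le_div_iff₀ (pow_pos (norm_pos_iff.2 hv) 2)] at h1
  have hlam : lambdaMin A = ρ := IsLeast.csInf_eq ⟨hray, fun r hr => by
    obtain ⟨v, hv⟩ := Module.End.HasEigenvalue.exists_hasEigenvector hr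
    have h1 := hin v v
    rw [hv.apply_eq_smul, real_inner_smul_left, real_inner_self_eq_norm_sq,
      real_inner_self_eq_norm_sq] at h1
    have h2 := hρle v
    rw [← h1] at h2
    exact le_of_mul_le_mul_right h2 (pow_pos (norm_pos_iff.2 hv.2) 2)⟩
  rw [hlam]
  exact ⟨hpos ρ hray, hρle⟩

theorem inner_opB_left (A : E m →L[ℝ] E p) (β τ : ℝ) (v w : E m) :
    inner ℝ (opB A β τ v) w = inner ℝ v (opB A β τ w) := by
  have h : inner ℝ (tr A (A v)) w = inner ℝ v (tr A (A w)) := by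
    rw [inner_tr_left, inner_tr_right]
  simp [opB, inner_sub_left, inner_sub_right, real_inner_smul_left, real_inner_smul_right, h]

/-- Expanding the square and using `‖AᵀAv‖ ≤ ‖A‖‖Av‖` gives `‖Bv‖² ≤ τ²‖v‖² - β(2τ - β‖A‖²)‖Av‖²`,
which is where `2τ ≥ β‖A‖²` enters. -/
theorem norm_opB_le (A : E m →L[ℝ] E p) {β τ : ℝ} (hβ : 0 < β) (hτ : 0 < τ)
    (hτβ : β * ‖A‖ ^ 2 ≤ 2 * τ) (v : E m) : ‖opB A β τ v‖ ≤ τ * ‖v‖ := by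
  refine (abs_le_of_sq_le_sq' ?_ (by positivity)).2
  have h0 : opB A β τ v = τ • v - β • tr A (A v) := by simp [opB]
  have h1 : ‖tr A (A v)‖ ≤ ‖A‖ * ‖A v‖ := by
    simpa using (tr A).le_opNorm (A v)
  have h2 : inner ℝ v (tr A (A v)) = ‖A v‖ ^ 2 := by
    rw [inner_tr_right, real_inner_self_eq_norm_sq]
  rw [h0, norm_sub_sq_real, real_inner_smul_left, real_inner_smul_right, h2, norm_smul, norm_smul,
    Real.norm_of_nonneg hβ.le, Real.norm_of_nonneg hτ.le]
  have h3 : ‖tr A (A v)‖ ^ 2 ≤ ‖A‖ ^ 2 * ‖A v‖ ^ 2 := by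
    rw [← mul_pow]; exact pow_le_pow_left₀ (norm_nonneg _) h1 2
  have h4 := mul_le_mul_of_nonneg_left h3 (sq_nonneg β)
  have h5 := mul_le_mul_of_nonneg_right hτβ (mul_nonneg hβ.le (sq_nonneg ‖A v‖))
  nlinarith

/-! ### Partial gradients of `H` and their descent inequalities -/

section Gradients

variable {H : E m × E q → ℝ}

theorem gradX_hasFDerivAt (hH : ContDiff ℝ 1 H) (x : E m) (y : E q) :
    HasFDerivAt (fun v => H (v, y)) (innerSL ℝ (gradX H x y)) x := by
  have h : DifferentiableAt ℝ (fun v => H (v, y)) x :=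
    ((hH.differentiable (by norm_num)).comp (differentiable_id.prodMk (differentiable_const y))) x
  exact h.hasGradientAt.hasFDerivAt

theorem gradY_hasFDerivAt (hH : ContDiff ℝ 1 H) (x : E m) (y : E q) :
    HasFDerivAt (fun v => H (x, v)) (innerSL ℝ (gradY H x y)) y := by
  have h : DifferentiableAt ℝ (fun v => H (x, v)) y :=
    ((hH.differentiable (by norm_num)).comp ((differentiable_const x).prodMk differentiable_id)) y
  exact h.hasGradientAt.hasFDerivAt

theorem fderiv_inl (hH : ContDiff ℝ 1 H) (x : E m) (y : E q) :
    (fderiv ℝ H (x, y)).comp (ContinuousLinearMap.inl ℝ (E m) (E q)) =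
      innerSL ℝ (gradX H x y) :=
  (((hH.differentiable (by norm_num)) (x, y)).hasFDerivAt.comp x
    (hasFDerivAt_prodMk_left x y)).unique (gradX_hasFDerivAt hH x y)

theorem fderiv_inr (hH : ContDiff ℝ 1 H) (x : E m) (y : E q) :
    (fderiv ℝ H (x, y)).comp (ContinuousLinearMap.inr ℝ (E m) (E q)) =
      innerSL ℝ (gradY H x y) :=
  (((hH.differentiable (by norm_num)) (x, y)).hasFDerivAt.comp y
    (hasFDerivAt_prodMk_right x y)).unique (gradY_hasFDerivAt hH x y)

theorem fderiv_apply_eq_gradX_add_gradY (hH : ContDiff ℝ 1 H) (x : E m) (y : E q)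
    (v : E m × E q) :
    fderiv ℝ H (x, y) v = inner ℝ (gradX H x y) v.1 + inner ℝ (gradY H x y) v.2 := by
  have h1 := congrArg (fun T => T v.1) (fderiv_inl hH x y)
  have h2 := congrArg (fun T => T v.2) (fderiv_inr hH x y)
  simp only [ContinuousLinearMap.comp_apply, ContinuousLinearMap.inl_apply,
    ContinuousLinearMap.inr_apply, innerSL_apply_apply] at h1 h2
  rw [← h1, ← h2, ← map_add]
  simp

theorem continuous_gradX (hH : ContDiff ℝ 1 H) :
    Continuous fun v : E m × E q => gradX H v.1 v.2 := by
  have h : (fun v : E m × E q => gradX H v.1 v.2) = fun v => (InnerProductSpace.toDual ℝ (E m)).symm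
      ((fderiv ℝ H v).comp (ContinuousLinearMap.inl ℝ (E m) (E q))) := by
    ext1 v
    rw [LinearIsometryEquiv.eq_symm_apply]
    exact (fderiv_inl hH v.1 v.2).symm
  rw [h]
  exact (LinearIsometryEquiv.continuous _).comp
    ((hH.continuous_fderiv (by norm_num)).clm_comp continuous_const)

theorem tendsto_gradX (hH : ContDiff ℝ 1 H) {ι : Type*} {l : Filter ι} {f : ι → E m} {g : ι → E q}
    {x : E m} {y : E q} (hf : Tendsto f l (𝓝 x)) (hg : Tendsto g l (𝓝 y)) :
    Tendsto (fun i => gradX H (f i) (g i)) l (𝓝 (gradX H x y)) := by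
  have h1 := (continuous_gradX hH).tendsto (x, y)
  have h2 := h1.comp (hf.prodMk_nhds hg)
  simpa only [Function.comp_def] using h2

theorem continuous_gradY (hH : ContDiff ℝ 1 H) :
    Continuous fun v : E m × E q => gradY H v.1 v.2 := by
  have h : (fun v : E m × E q => gradY H v.1 v.2) = fun v => (InnerProductSpace.toDual ℝ (E q)).symm
      ((fderiv ℝ H v).comp (ContinuousLinearMap.inr ℝ (E m) (E q))) := by
    ext1 v
    rw [LinearIsometryEquiv.eq_symm_apply]
    exact (fderiv_inr hH v.1 v.2).symm
  rw [h]
  exact (LinearIsometryEquiv.continuous _).comp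
    ((hH.continuous_fderiv (by norm_num)).clm_comp continuous_const)

theorem tendsto_gradY (hH : ContDiff ℝ 1 H) {ι : Type*} {l : Filter ι} {f : ι → E m} {g : ι → E q}
    {x : E m} {y : E q} (hf : Tendsto f l (𝓝 x)) (hg : Tendsto g l (𝓝 y)) :
    Tendsto (fun i => gradY H (f i) (g i)) l (𝓝 (gradY H x y)) := by
  have h1 := (continuous_gradY hH).tendsto (x, y)
  have h2 := h1.comp (hf.prodMk_nhds hg)
  simpa only [Function.comp_def] using h2

variable {L : ℝ} {B₁ : Set (E m)} {B₂ : Set (E q)}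

theorem GradLipschitzOn.sqrt_le (hL : 0 < L) (a b : ℝ) (ha : 0 ≤ a) (hb : 0 ≤ b) :
    L * √(a ^ 2 + b ^ 2) ≤ L * (a + b) := by
  refine mul_le_mul_of_nonneg_left ?_ hL.le
  rw [Real.sqrt_le_left (by positivity)]
  nlinarith [mul_nonneg ha hb]

theorem GradLipschitzOn.gradX_le (h : GradLipschitzOn H L B₁ B₂) (hL : 0 < L) {x x' : E m}
    {y y' : E q} (hx : x ∈ B₁) (hy : y ∈ B₂) (hx' : x' ∈ B₁) (hy' : y' ∈ B₂) :
    ‖gradX H x y - gradX H x' y'‖ ≤ L * (‖x - x'‖ + ‖y - y'‖) :=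
  ((Real.le_sqrt (norm_nonneg _) (by positivity)).2 
    (by nlinarith [sq_nonneg ‖gradY H x y - gradY H x' y'‖])).trans ((h x hx y hy x' hx' y' hy').trans
    (GradLipschitzOn.sqrt_le hL _ _ (norm_nonneg _) (norm_nonneg _)))

theorem GradLipschitzOn.gradY_le (h : GradLipschitzOn H L B₁ B₂) (hL : 0 < L) {x x' : E m}
    {y y' : E q} (hx : x ∈ B₁) (hy : y ∈ B₂) (hx' : x' ∈ B₁) (hy' : y' ∈ B₂) :
    ‖gradY H x y - gradY H x' y'‖ ≤ L * (‖x - x'‖ + ‖y - y'‖) :=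
  ((Real.le_sqrt (norm_nonneg _) (by positivity)).2 
    (by nlinarith [sq_nonneg ‖gradX H x y - gradX H x' y'‖])).trans ((h x hx y hy x' hx' y' hy').trans
    (GradLipschitzOn.sqrt_le hL _ _ (norm_nonneg _) (norm_nonneg _)))

theorem GradLipschitzOn.descent_x (h : GradLipschitzOn H L B₁ B₂) (hL : 0 < L)
    (hH : ContDiff ℝ 1 H) (hB : Convex ℝ B₁) {x x' : E m} {y : E q}
    (hx : x ∈ B₁) (hx' : x' ∈ B₁) (hy : y ∈ B₂) :
    H (x', y) ≤ H (x, y) + inner ℝ (gradX H x y) (x' - x) + L / 2 * ‖x' - x‖ ^ 2 := by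
  have := descent_segment (a := x) (d := x' - x) (L := L) (fun v => gradX_hasFDerivAt hH v y)
    fun t ht => by
      have := h.gradX_le hL (hB.add_smul_sub_mem hx hx' ht) hy hx hy
      simpa [norm_smul, abs_of_nonneg ht.1] using this
  simpa using this

theorem GradLipschitzOn.descent_y (h : GradLipschitzOn H L B₁ B₂) (hL : 0 < L)
    (hH : ContDiff ℝ 1 H) (hB : Convex ℝ B₂) {x : E m} {y y' : E q}
    (hx : x ∈ B₁) (hy : y ∈ B₂) (hy' : y' ∈ B₂) :
    H (x, y') ≤ H (x, y) + inner ℝ (gradY H x y) (y' - y) + L / 2 * ‖y' - y‖ ^ 2 := by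
  have := descent_segment (a := y) (d := y' - y) (L := L) (fun v => gradY_hasFDerivAt hH x v)
    fun t ht => by
      have := h.gradY_le hL hx (hB.add_smul_sub_mem hy hy' ht) hx hy
      simpa [norm_smul, abs_of_nonneg ht.1] using this
  simpa using this

end Gradients

/-! ### One-step estimates for the primal and multiplier updates -/

/-- Change of the augmented Lagrangian in the two linear steps of the algorithm. -/
theorem lagrangian_xu_step (A : E m →L[ℝ] E p) {β τ σ : ℝ} (hβ : 0 < β) (hτ : 0 < τ) (hσ : 0 < σ)
    {x₀ x₁ g : E m} {z u₀ u₁ : E p}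
    (hx : x₁ = x₀ - τ⁻¹ • (g + tr A u₀ + β • tr A (A x₀ - z)))
    (hu : u₁ = u₀ + (σ * β) • (A x₁ - z)) :
    inner ℝ u₁ (A x₁ - z) + β / 2 * ‖A x₁ - z‖ ^ 2 + inner ℝ g (x₁ - x₀)
        + (τ - β * ‖A‖ ^ 2 / 2) * ‖x₁ - x₀‖ ^ 2
      ≤ inner ℝ u₀ (A x₀ - z) + β / 2 * ‖A x₀ - z‖ ^ 2 + 1 / (σ * β) * ‖u₁ - u₀‖ ^ 2 := by
  have hg : g + tr A u₀ + β • tr A (A x₀ - z) = -(τ • (x₁ - x₀)) := by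
    rw [hx, sub_sub_cancel_left, smul_neg, neg_neg, smul_smul, mul_inv_cancel₀ hτ.ne', one_smul]
  have h1 := congrArg (fun v => inner ℝ v (x₁ - x₀)) hg
  simp only [inner_add_left, inner_neg_left, real_inner_smul_left, inner_tr_left,
    real_inner_self_eq_norm_sq] at h1
  have hr : A x₁ - z = (A x₀ - z) + A (x₁ - x₀) := by rw [map_sub]; abel
  have hdu : u₁ - u₀ = (σ * β) • (A x₁ - z) := by rw [hu]; abel
  -- This is the increase caused by the dual update, the only one in the scheme that works against
  -- descent.
  have h2 : 1 / (σ * β) * ‖u₁ - u₀‖ ^ 2 = inner ℝ (u₁ - u₀) (A x₁ - z) := by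
    rw [hdu, norm_smul, real_inner_smul_left, real_inner_self_eq_norm_sq,
      Real.norm_of_nonneg (by positivity)]
    field_simp
  have h3 : ‖A (x₁ - x₀)‖ ^ 2 ≤ ‖A‖ ^ 2 * ‖x₁ - x₀‖ ^ 2 := by
    rw [← mul_pow]; exact pow_le_pow_left₀ (norm_nonneg _) (A.le_opNorm _) 2
  rw [h2, inner_sub_left]
  rw [hr, norm_add_sq_real, inner_add_right, inner_add_right]
  nlinarith

/-- The regularizing vector `Aᵀ(u - u') + σB(x - x')`. -/
noncomputable def regVec (A : E m →L[ℝ] E p) (β τ σ : ℝ) (x x' : E m) (u u' : E p) : E m :=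
  tr A (u - u') + σ • opB A β τ (x - x')

/-- The `u`-step contributes `σβAᵀA(x₁ - x₀)` through the residual at `x₁`, which the `βAᵀA` part of
`B` cancels; the remaining `στ(x₁ - x₀)` is replaced by means of the `x`-step. No difference of
iterates is left. -/
theorem regVec_step (A : E m →L[ℝ] E p) {β τ σ : ℝ} (hτ : 0 < τ)
    {x₀ x₁ g : E m} {z u₀ u₁ : E p}
    (hx : x₁ = x₀ - τ⁻¹ • (g + tr A u₀ + β • tr A (A x₀ - z)))
    (hu : u₁ = u₀ + (σ * β) • (A x₁ - z)) :
    regVec A β τ σ x₁ x₀ u₁ u₀ = -(σ • (tr A u₀ + g)) := by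
  have hg : g + tr A u₀ = -(τ • (x₁ - x₀)) - β • tr A (A x₀ - z) := by
    rw [hx, sub_sub_cancel_left, smul_neg, neg_neg, smul_smul, mul_inv_cancel₀ hτ.ne', one_smul]
    abel
  have hdu : u₁ - u₀ = (σ * β) • ((A x₀ - z) + A (x₁ - x₀)) := by
    rw [hu, map_sub, add_sub_cancel_left]; congr 1; abel
  rw [add_comm (tr A u₀), hg, regVec, hdu]
  simp only [opB, map_smul, map_add, sub_apply, smul_apply,
    ContinuousLinearMap.id_apply, ContinuousLinearMap.comp_apply]
  module

/-- The scalar estimate of the multiplier step. -/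
theorem multiplier_estimate {β τ σ L lam w₀ w₁ r t a b c d : ℝ} (hβ : 0 < β)
    (hσ : 0 < σ) (hσ1 : σ ≤ 1) (hL : 0 < L) (hlam : 0 < lam)
    (hw₁ : 0 ≤ w₁) (hr : 0 ≤ r) (ht : 0 ≤ t) (ha : 0 ≤ a)
    (h1 : w₁ ≤ (1 - σ) * w₀ + σ * r) (h2 : r ≤ (σ * τ + L) * a + L * b)
    (h3 : t ≤ w₁ + σ * (τ * c)) (h4 : lam * d ^ 2 ≤ t ^ 2) :
    2 / (σ * β) * d ^ 2 ≤ 4 * (1 - σ) / (σ ^ 2 * β * lam) * (w₀ ^ 2 - w₁ ^ 2)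
      + 8 * (σ * τ + L * √2) ^ 2 / (σ * β * lam) * a ^ 2
      + 16 * L ^ 2 / (σ * β * lam) * b ^ 2 + 4 * σ * τ ^ 2 / (β * lam) * c ^ 2 := by
  have hs2 : 1 ≤ √2 := Real.one_le_sqrt.2 (by norm_num)
  -- Convexity of the square with weights `1 - σ` and `σ`; this uses `σ ≤ 1`.
  have e1 : w₁ ^ 2 ≤ (1 - σ) * w₀ ^ 2 + σ * r ^ 2 := by
    have := pow_le_pow_left₀ hw₁ h1 2
    nlinarith [mul_nonneg (mul_nonneg hσ.le (sub_nonneg.2 hσ1)) (sq_nonneg (w₀ - r))]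
  have e2 : r ^ 2 ≤ 2 * (σ * τ + L * √2) ^ 2 * a ^ 2 + 4 * L ^ 2 * b ^ 2 := by
    have h5 : r ≤ (σ * τ + L * √2) * a + L * b := by
      refine h2.trans ?_
      gcongr
      nlinarith
    have := pow_le_pow_left₀ hr h5 2
    nlinarith [sq_nonneg ((σ * τ + L * √2) * a - L * b), sq_nonneg (L * b)]
  have e3 : lam * d ^ 2 ≤ 2 * w₁ ^ 2 + 2 * σ ^ 2 * τ ^ 2 * c ^ 2 := by
    have := pow_le_pow_left₀ ht h3 2
    nlinarith [sq_nonneg (w₁ - σ * (τ * c))]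
  set Q := (σ * τ + L * √2) ^ 2
  -- `e1` rearranges to `σw₁² ≤ (1 - σ)(w₀² - w₁²) + σr²`, so the term in `w₁` turns into a
  -- telescoping difference.
  have key : σ * lam * d ^ 2 ≤ 2 * ((1 - σ) * (w₀ ^ 2 - w₁ ^ 2)
      + σ * (2 * Q * a ^ 2 + 4 * L ^ 2 * b ^ 2)) + σ * (2 * σ ^ 2 * τ ^ 2 * c ^ 2) := by
    have := mul_le_mul_of_nonneg_left e3 hσ.le
    have := mul_le_mul_of_nonneg_left e2 hσ.le
    nlinarith
  have hpos : 0 < 2 / (σ ^ 2 * β * lam) := by positivity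
  have := mul_le_mul_of_nonneg_left key hpos.le
  refine le_trans (le_of_eq ?_) (this.trans (le_of_eq ?_))
  · field_simp
  · field_simp
    ring

end FullSplitting

/-! ### The product space and subgradients of `Ψ` -/

namespace FullSplitting

variable {m q p : ℕ}

/-- The point of `RSpace m q p` with the given blocks. -/
abbrev rpoint (x : E m) (y : E q) (z u : E p) (x' : E m) (u' : E p) : RSpace m q p :=
  WithLp.toLp 2 (x, WithLp.toLp 2 (y, WithLp.toLp 2 (z, WithLp.toLp 2 (u, WithLp.toLp 2 (x', u')))))

theorem continuous_rpoint : Continuous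
    fun v : E m × E q × E p × E p × E m × E p =>
      rpoint v.1 v.2.1 v.2.2.1 v.2.2.2.1 v.2.2.2.2.1 v.2.2.2.2.2 := by
  unfold rpoint
  fun_prop

theorem norm_rpoint_le (x : E m) (y : E q) (z u : E p) (x' : E m) (u' : E p) :
    ‖rpoint x y z u x' u'‖ ≤ ‖x‖ + (‖y‖ + (‖z‖ + (‖u‖ + (‖x'‖ + ‖u'‖)))) := by
  have key : ∀ {V W : Type} [NormedAddCommGroup V] [NormedAddCommGroup W] (v : V) (w : W),
      ‖WithLp.toLp 2 (v, w)‖ ≤ ‖v‖ + ‖w‖ := fun v w => by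
    refine (abs_le_of_sq_le_sq' ?_ (by positivity)).2
    rw [WithLp.prod_norm_sq_eq_of_L2]
    have := mul_nonneg (norm_nonneg v) (norm_nonneg w)
    change ‖v‖ ^ 2 + ‖w‖ ^ 2 ≤ _
    nlinarith
  unfold rpoint
  repeat first
    | exact key _ _
    | refine (key _ _).trans (add_le_add_right ?_ _)

theorem tendsto_rpoint {ι : Type*} {f : Filter ι} {x x' : ι → E m} {y : ι → E q}
    {z u u' : ι → E p} {xs xs' : E m} {ys : E q} {zs us us' : E p}
    (hx : Tendsto x f (𝓝 xs)) (hy : Tendsto y f (𝓝 ys)) (hz : Tendsto z f (𝓝 zs))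
    (hu : Tendsto u f (𝓝 us)) (hx' : Tendsto x' f (𝓝 xs')) (hu' : Tendsto u' f (𝓝 us')) :
    Tendsto (fun i => rpoint (x i) (y i) (z i) (u i) (x' i) (u' i)) f
      (𝓝 (rpoint xs ys zs us xs' us')) :=
  ((continuous_rpoint (m := m) (q := q) (p := p)).tendsto (xs, ys, zs, us, xs', us')).comp
    (hx.prodMk_nhds (hy.prodMk_nhds (hz.prodMk_nhds (hu.prodMk_nhds (hx'.prodMk_nhds hu')))))

/-- The objective of the `y`-step without `G`. -/
noncomputable def yModel (g : E q) (μ : ℝ) (y₀ : E q) (v : E q) : ℝ :=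
  inner ℝ g v + μ / 2 * ‖v - y₀‖ ^ 2

/-- The objective of the `z`-step without `F`; here `r` stands for `A x_n`. -/
noncomputable def zModel (u₀ : E p) (β : ℝ) (r : E p) (w : E p) : ℝ :=
  inner ℝ u₀ (r - w) + β / 2 * ‖r - w‖ ^ 2

/-- The smooth part of the regularized augmented Lagrangian. -/
noncomputable def smoothPart (A : E m →L[ℝ] E p) (H : E m × E q → ℝ) (β τ C₀ C₁ σ : ℝ)
    (x : E m) (y : E q) (z u : E p) (x' : E m) (u' : E p) : ℝ :=
  H (x, y) + inner ℝ u (A x - z) + β / 2 * ‖A x - z‖ ^ 2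
      + C₀ * ‖regVec A β τ σ x x' u u'‖ ^ 2 + C₁ * ‖x - x'‖ ^ 2

theorem yModel_hasFDerivAt (g : E q) (μ : ℝ) (y₀ v : E q) :
    HasFDerivAt (yModel g μ y₀) (innerSL ℝ (g + μ • (v - y₀))) v := by
  have h1 := ((innerSL ℝ g).hasFDerivAt (x := v)).add
    ((((hasFDerivAt_id (𝕜 := ℝ) v).sub_const y₀).norm_sq).const_mul (μ / 2))
  refine h1.congr_fderiv ?_
  ext w
  simp
  ring

theorem zModel_hasFDerivAt (u₀ : E p) (β : ℝ) (r w : E p) :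
    HasFDerivAt (zModel u₀ β r) (innerSL ℝ (-(u₀ + β • (r - w)))) w := by
  have h0 := (hasFDerivAt_id (𝕜 := ℝ) w).const_sub r
  have h1 := (((innerSL ℝ u₀).hasFDerivAt (x := r - w)).comp w h0).add
    ((h0.norm_sq).const_mul (β / 2))
  refine h1.congr_fderiv ?_
  ext w
  simp
  ring

theorem continuous_smoothPart (A : E m →L[ℝ] E p) {H : E m × E q → ℝ} (hH : Continuous H)
    (β τ C₀ C₁ σ : ℝ) : Continuous fun v : E m × E q × E p × E p × E m × E p =>
      smoothPart A H β τ C₀ C₁ σ v.1 v.2.1 v.2.2.1 v.2.2.2.1 v.2.2.2.2.1 v.2.2.2.2.2 := by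
  unfold smoothPart regVec
  fun_prop

/-- The gradient of the smooth part. -/
theorem smoothPart_hasFDerivAt (A : E m →L[ℝ] E p) {H : E m × E q → ℝ} (hH : ContDiff ℝ 1 H)
    (β τ C₀ C₁ σ : ℝ) (x : E m) (y : E q) (z u : E p) (x' : E m) (u' : E p) :
    HasFDerivAt (fun X : RSpace m q p => smoothPart A H β τ C₀ C₁ σ X.fst X.snd.fst X.snd.snd.fst
        X.snd.snd.snd.fst X.snd.snd.snd.snd.fst X.snd.snd.snd.snd.snd)
      (innerSL ℝ (rpoint
        (gradX H x y + tr A u + β • tr A (A x - z)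
          + (2 * C₀ * σ) • opB A β τ (regVec A β τ σ x x' u u') + (2 * C₁) • (x - x'))
        (gradY H x y)
        (-(u + β • (A x - z)))
        ((A x - z) + (2 * C₀) • A (regVec A β τ σ x x' u u'))
        (-((2 * C₀ * σ) • opB A β τ (regVec A β τ σ x x' u u') + (2 * C₁) • (x - x')))
        (-((2 * C₀) • A (regVec A β τ σ x x' u u')))))
      (rpoint x y z u x' u') := by
  let P0 := WithLp.sndL 2 ℝ (E m)
    (WithLp 2 (E q × WithLp 2 (E p × WithLp 2 (E p × WithLp 2 (E m × E p)))))
  let P1 := (WithLp.sndL 2 ℝ (E q) (WithLp 2 (E p × WithLp 2 (E p × WithLp 2 (E m × E p))))).comp P0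
  let P2 := (WithLp.sndL 2 ℝ (E p) (WithLp 2 (E p × WithLp 2 (E m × E p)))).comp P1
  let P3 := (WithLp.sndL 2 ℝ (E p) (WithLp 2 (E m × E p))).comp P2
  let X : RSpace m q p := rpoint x y z u x' u'
  have hx := (WithLp.fstL 2 ℝ (E m)
    (WithLp 2 (E q × WithLp 2 (E p × WithLp 2 (E p × WithLp 2 (E m × E p)))))).hasFDerivAt (x := X)
  have hy := ((WithLp.fstL 2 ℝ (E q)
    (WithLp 2 (E p × WithLp 2 (E p × WithLp 2 (E m × E p))))).comp P0).hasFDerivAt (x := X)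
  have hz := ((WithLp.fstL 2 ℝ (E p) (WithLp 2 (E p × WithLp 2 (E m × E p)))).comp
    P1).hasFDerivAt (x := X)
  have hu := ((WithLp.fstL 2 ℝ (E p) (WithLp 2 (E m × E p))).comp P2).hasFDerivAt (x := X)
  have hx' := ((WithLp.fstL 2 ℝ (E m) (E p)).comp P3).hasFDerivAt (x := X)
  have hu' := ((WithLp.sndL 2 ℝ (E m) (E p)).comp P3).hasFDerivAt (x := X)
  have hr := (A.hasFDerivAt.comp X hx).sub hz
  have hdx := hx.sub hx'
  have hw := ((tr A).hasFDerivAt.comp X (hu.sub hu')).add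
    (((opB A β τ).hasFDerivAt.comp X hdx).const_smul σ)
  have hHX : HasFDerivAt H (fderiv ℝ H (x, y)) (x, y) :=
    ((hH.differentiable (by norm_num)) (x, y)).hasFDerivAt
  have h1 := HasFDerivAt.comp X (f := fun X : RSpace m q p => (X.fst, X.snd.fst)) (g := H)
    hHX (hx.prodMk hy)
  have h := (((h1.add (hu.inner ℝ hr)).add (hr.norm_sq.const_mul (β / 2))).add
    (hw.norm_sq.const_mul C₀)).add (hdx.norm_sq.const_mul C₁)
  refine h.congr_fderiv ?_
  ext v
  simp only [add_apply, smul_apply, sub_apply, ContinuousLinearMap.comp_apply,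
    fderiv_apply_eq_gradX_add_gradY hH, innerSL_apply_apply, WithLp.prod_inner_apply]
  obtain ⟨⟨a, ⟨⟨b, ⟨⟨c, ⟨⟨d, ⟨⟨a', d'⟩⟩⟩⟩⟩⟩⟩⟩⟩⟩ := v
  set w := regVec A β τ σ x x' u u' with hw0
  change inner ℝ (gradX H x y) a + inner ℝ (gradY H x y) b
      + (inner ℝ u (A a - c) + inner ℝ d (A x - z))
      + (β / 2) • 2 • inner ℝ (A x - z) (A a - c)
      + C₀ • 2 • inner ℝ w (tr A (d - d') + σ • opB A β τ (a - a'))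
      + C₁ • 2 • inner ℝ (x - x') (a - a') =
    inner ℝ (gradX H x y + tr A u + β • tr A (A x - z) + (2 * C₀ * σ) • opB A β τ w
        + (2 * C₁) • (x - x')) a
      + (inner ℝ (gradY H x y) b + (inner ℝ (-(u + β • (A x - z))) c
      + (inner ℝ (A x - z + (2 * C₀) • A w) d
      + (inner ℝ (-((2 * C₀ * σ) • opB A β τ w + (2 * C₁) • (x - x'))) a'
      + inner ℝ (-((2 * C₀) • A w)) d'))))
  -- Hiding these differences keeps the bilinear expansion below from splitting them.
  generalize x - x' = e
  rw [real_inner_comm (A x - z) d]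
  generalize A x - z = r
  simp only [inner_add_left, inner_add_right, inner_sub_right, inner_neg_left,
    real_inner_smul_left, real_inner_smul_right, inner_tr_left, inner_tr_right, inner_opB_left,
    map_sub, smul_eq_mul, nsmul_eq_mul]
  push_cast
  ring

/-- The value of `Ψ` in terms of the smooth part. -/
theorem Psi_rpoint (A : E m →L[ℝ] E p) (F : E p → EReal) (G : E q → EReal) (H : E m × E q → ℝ)
    (β τ σ L : ℝ) (x : E m) (y : E q) (z u : E p) (x' : E m) (u' : E p) :
    Psi A F G H β τ σ L (rpoint x y z u x' u') = F z + G y +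
      ((smoothPart A H β τ (constC0 A β σ) (constC1 A β τ σ L) σ x y z u x' u' : ℝ) : EReal) :=
  rfl

/-- Minimality of `v₁` for `f + h` supplies a minorant of `f` that touches it at `v₁` and is as
smooth as `h`. It serves both for comparing values and for producing subgradients. -/
theorem le_sub_of_isMinOn {V : Type*} {f : V → EReal} {h : V → ℝ} {v₁ : V} {r : ℝ}
    (hmin : IsMinOn (fun v => f v + (h v : EReal)) univ v₁) (hr : f v₁ = (r : EReal)) (v : V) :
    ((r + h v₁ - h v : ℝ) : EReal) ≤ f v := by
  have h1 := hmin (mem_univ v)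
  simp only [mem_ofPred_eq, hr] at h1
  induction hv : f v with
  | bot => rw [hv, EReal.bot_add, ← EReal.coe_add] at h1; simp at h1
  | top => exact le_top
  | coe s =>
    rw [hv, ← EReal.coe_add, ← EReal.coe_add, EReal.coe_le_coe_iff] at h1
    rw [EReal.coe_le_coe_iff]
    linarith

theorem exists_coe_of_isMinOn {V : Type*} [NormedAddCommGroup V] {f : V → EReal} {h : V → ℝ}
    (hf : IsProper f) {v₁ : V} (hmin : IsMinOn (fun v => f v + (h v : EReal)) univ v₁) :
    f v₁ = ((f v₁).toReal : EReal) := by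
  refine (EReal.coe_toReal (fun htop => ?_) (hf.1 _)).symm
  obtain ⟨v₀, hv₀⟩ := hf.2
  have h1 := hmin (mem_univ v₀)
  simp only [mem_ofPred_eq, htop] at h1
  rw [EReal.top_add_coe, top_le_iff] at h1
  rw [← EReal.coe_toReal hv₀ (hf.1 _), ← EReal.coe_add] at h1
  exact EReal.coe_ne_top _ h1

section Steps

variable {A : E m →L[ℝ] E p} {F : E p → EReal} {G : E q → EReal} {H : E m × E q → ℝ}
  {μ β τ σ L : ℝ}

theorem neg_mem_frechetSubdiff_of_isMinOn {V : Type*} [NormedAddCommGroup V] [InnerProductSpace ℝ V]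
    {f : V → EReal} {h : V → ℝ} (hf : IsProper f) {v₁ d : V}
    (hmin : IsMinOn (fun v => f v + (h v : EReal)) univ v₁)
    (hd : HasFDerivAt h (innerSL ℝ d) v₁) : -d ∈ frechetSubdiff f v₁ := by
  have hr := exists_coe_of_isMinOn hf hmin
  refine mem_frechetSubdiff_of_minorant (T := fun v => (f v₁).toReal + h v₁ - h v) (by simpa using hr)
    (le_sub_of_isMinOn hmin hr) ?_
  rw [map_neg]
  exact hd.const_sub _

/-- A Fréchet subgradient of `Ψ` at an iterate. -/
theorem mem_frechetSubdiff_Psi (hF : IsProper F) (hG : IsProper G) (hH : ContDiff ℝ 1 H)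
    {x x' : E m} {y y' g : E q} {z u u' r : E p}
    (hy : IsMinOn (fun v => G v + (yModel g μ y' v : EReal)) univ y)
    (hz : IsMinOn (fun w => F w + (zModel u' β r w : EReal)) univ z) :
    rpoint
        (gradX H x y + tr A u + β • tr A (A x - z)
          + (2 * constC0 A β σ * σ) • opB A β τ (regVec A β τ σ x x' u u')
          + (2 * constC1 A β τ σ L) • (x - x'))
        (gradY H x y - (g + μ • (y - y')))
        (-(u + β • (A x - z)) + (u' + β • (r - z)))
        ((A x - z) + (2 * constC0 A β σ) • A (regVec A β τ σ x x' u u'))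
        (-((2 * constC0 A β σ * σ) • opB A β τ (regVec A β τ σ x x' u u')
          + (2 * constC1 A β τ σ L) • (x - x')))
        (-((2 * constC0 A β σ) • A (regVec A β τ σ x x' u u')))
      ∈ frechetSubdiff (Psi A F G H β τ σ L) (rpoint x y z u x' u') := by
  have hzr := exists_coe_of_isMinOn hF hz
  have hyr := exists_coe_of_isMinOn hG hy
  set C₀ := constC0 A β σ with hC₀
  set C₁ := constC1 A β τ σ L with hC₁
  -- `F` and `G` are replaced by the minorants that the `z`- and `y`-steps provide. The result is a
  -- differentiable minorant of `Ψ` with equality at the iterate, so no sum rule for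
  -- subdifferentials is needed.
  refine mem_frechetSubdiff_of_minorant
    (T := fun X : RSpace m q p => smoothPart A H β τ C₀ C₁ σ X.fst X.snd.fst X.snd.snd.fst
        X.snd.snd.snd.fst X.snd.snd.snd.snd.fst X.snd.snd.snd.snd.snd
        + ((F z).toReal + zModel u' β r z - zModel u' β r X.snd.snd.fst)
        + ((G y).toReal + yModel g μ y' y - yModel g μ y' X.snd.fst)) ?_ (fun X => ?_) ?_
  · rw [Psi_rpoint, hzr, hyr]
    norm_cast
    simp only [EReal.toReal_coe]
    change _ = smoothPart A H β τ C₀ C₁ σ x y z u x' u' + ((F z).toReal + zModel u' β r z -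
      zModel u' β r z) + ((G y).toReal + yModel g μ y' y - yModel g μ y' y)
    ring
  · rw [add_assoc, add_comm, EReal.coe_add, EReal.coe_add]
    exact add_le_add (add_le_add (le_sub_of_isMinOn hz hzr _) (le_sub_of_isMinOn hy hyr _)) le_rfl
  · have h1 := smoothPart_hasFDerivAt A hH β τ C₀ C₁ σ x y z u x' u'
    have hzp := HasFDerivAt.comp (rpoint x y z u x' u')
      (f := fun X : RSpace m q p => X.snd.snd.fst) (g := zModel u' β r)
      (zModel_hasFDerivAt u' β r z)
      ((WithLp.fstL 2 ℝ (E p) (WithLp 2 (E p × WithLp 2 (E m × E p)))).hasFDerivAt.comp _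
        ((WithLp.sndL 2 ℝ (E q) (WithLp 2 (E p × WithLp 2 (E p × WithLp 2 (E m × E p))))).hasFDerivAt.comp
          _ (WithLp.sndL 2 ℝ (E m) (WithLp 2 (E q × WithLp 2 (E p × WithLp 2 (E p ×
            WithLp 2 (E m × E p)))))).hasFDerivAt))
    have hyp := HasFDerivAt.comp (rpoint x y z u x' u')
      (f := fun X : RSpace m q p => X.snd.fst) (g := yModel g μ y')
      (yModel_hasFDerivAt g μ y' y)
      ((WithLp.fstL 2 ℝ (E q) (WithLp 2 (E p × WithLp 2 (E p × WithLp 2 (E m × E p))))).hasFDerivAt.comp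
          _ (WithLp.sndL 2 ℝ (E m) (WithLp 2 (E q × WithLp 2 (E p × WithLp 2 (E p ×
            WithLp 2 (E m × E p)))))).hasFDerivAt)
    refine ((h1.add (hzp.const_sub _)).add (hyp.const_sub _)).congr_fderiv ?_
    ext v
    simp only [add_apply, neg_apply, ContinuousLinearMap.comp_apply,
      innerSL_apply_apply, WithLp.prod_inner_apply]
    obtain ⟨⟨a, ⟨⟨b, ⟨⟨c, d⟩⟩⟩⟩⟩⟩ := v
    simp only [inner_add_left, inner_sub_left]
    change _ + -inner ℝ (-(u' + β • (r - z))) c + -(inner ℝ g b + inner ℝ (μ • (y - y')) b) = _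
    simp only [inner_add_left, inner_neg_left]
    ring

end Steps

end FullSplitting

/-! ### Sufficient decrease and vanishing steps -/

namespace FullSplitting

/-- Along convergent minimizers of `f + h_k`, with convergent perturbations `h_k`, the values of `f`
converge. -/
theorem tendsto_of_isMinOn {V : Type*} [NormedAddCommGroup V] {f : V → EReal} (hf : IsProper f)
    (hlsc : LowerSemicontinuous f) {vs : ℕ → V} {vl : V} {hs : ℕ → V → ℝ} {h : V → ℝ}
    (hmin : ∀ k, IsMinOn (fun v => f v + (hs k v : EReal)) univ (vs k))
    (hvs : Tendsto vs atTop (𝓝 vl))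
    (hlim : ∀ v, Tendsto (fun k => hs k v - hs k (vs k)) atTop (𝓝 (h v - h vl))) :
    f vl ≠ ⊤ ∧ Tendsto (fun k => f (vs k)) atTop (𝓝 (f vl)) := by
  have hr := fun k => exists_coe_of_isMinOn hf (hmin k)
  have hle : ∀ v (s : ℝ), f v = (s : EReal) → ∀ k,
      f (vs k) ≤ ((s + (hs k v - hs k (vs k)) : ℝ) : EReal) := fun v s hv k => by
    have h1 := le_sub_of_isMinOn (hmin k) (hr k) v
    rw [hv, EReal.coe_le_coe_iff] at h1
    rw [hr k, EReal.coe_le_coe_iff]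
    linarith
  have hlow : ∀ c < f vl, ∀ᶠ k in atTop, c < f (vs k) := fun c hc =>
    hvs.eventually (hlsc vl c hc)
  -- An infinite value at the limit would drive `f (vs k)` to infinity by semicontinuity, while
  -- comparison with a point of the domain keeps it bounded.
  have hfin : f vl ≠ ⊤ := fun htop => by
    obtain ⟨v₀, hv₀⟩ := hf.2
    have h0 := hle v₀ _ (EReal.coe_toReal hv₀ (hf.1 _)).symm
    have h1 := hlow (((f v₀).toReal + (h v₀ - h vl) + 1 : ℝ) : EReal)
      (by rw [htop]; exact EReal.coe_lt_top _)
    have h2 := ((hlim v₀).const_add (f v₀).toReal).eventually (gt_mem_nhds (lt_add_one _))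
    obtain ⟨k, hk1, hk2⟩ := (h1.and h2).exists
    have := hk1.trans_le (h0 k)
    rw [EReal.coe_lt_coe_iff] at this
    exact this.not_gt hk2
  refine ⟨hfin, tendsto_order.2 ⟨hlow, fun b hb => ?_⟩⟩
  -- Testing minimality against the limit point itself gives the upper bound, since the difference
  -- of perturbations tends to zero.
  have h0 := hle vl _ (EReal.coe_toReal hfin (hf.1 _)).symm
  have h1 : Tendsto (fun k => (((f vl).toReal + (hs k vl - hs k (vs k)) : ℝ) : EReal)) atTop
      (𝓝 (f vl)) := by
    have := (hlim vl).const_add (f vl).toReal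
    rw [sub_self, add_zero] at this
    have h2 := (continuous_coe_real_ereal.tendsto _).comp this
    rwa [EReal.coe_toReal hfin (hf.1 _)] at h2
  filter_upwards [h1.eventually (gt_mem_nhds hb)] with k hk
  exact (h0 k).trans_lt hk

variable {m q p : ℕ}

/-- The standing assumptions on the problem data and on the generated sequence. -/
structure Setting (A : E m →L[ℝ] E p) (F : E p → EReal) (G : E q → EReal)
    (H : E m × E q → ℝ) (μ β τ σ L : ℝ) (x : ℕ → E m) (y : ℕ → E q) (z u : ℕ → E p)
    (B₁ : Set (E m)) (B₂ : Set (E q)) : Prop where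
  lam_pos : 0 < lambdaMin A
  lam_le : ∀ v, lambdaMin A * ‖v‖ ^ 2 ≤ ‖tr A v‖ ^ 2
  F_proper : IsProper F
  F_lsc : LowerSemicontinuous F
  G_proper : IsProper G
  G_lsc : LowerSemicontinuous G
  H_contDiff : ContDiff ℝ 1 H
  F_bdd : IsBoundedBelow F
  G_bdd : IsBoundedBelow G
  H_bdd : BddBelow (Set.range H)
  β_pos : 0 < β
  τ_pos : 0 < τ
  σ_pos : 0 < σ
  σ_le : σ ≤ 1
  L_pos : 0 < L
  τβ : β * ‖A‖ ^ 2 ≤ 2 * τ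
  C_pos : 0 < min (constC2 A β τ σ L) (min (constC3 A μ β σ L) (constC4 β σ))
  gen : IsGenerated A F G H μ β τ σ x y z u
  x_bdd : Bornology.IsBounded (Set.range x)
  y_bdd : Bornology.IsBounded (Set.range y)
  z_bdd : Bornology.IsBounded (Set.range z)
  u_bdd : Bornology.IsBounded (Set.range u)
  B₁_convex : Convex ℝ B₁
  B₂_convex : Convex ℝ B₂
  mem : ∀ n, x n ∈ B₁ ∧ y n ∈ B₂
  lip : GradLipschitzOn H L B₁ B₂

/-- The iterates as points of the space on which `Ψ` lives. -/
noncomputable def iterate (x : ℕ → E m) (y : ℕ → E q) (z u : ℕ → E p) (n : ℕ) : RSpace m q p :=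
  rpoint (x (n + 1)) (y (n + 1)) (z (n + 1)) (u (n + 1)) (x n) (u n)

/-- The length of a step in the variables `x`, `y` and `u`. -/
noncomputable def stepLen (x : ℕ → E m) (y : ℕ → E q) (u : ℕ → E p) (n : ℕ) : ℝ :=
  ‖x (n + 1) - x n‖ + ‖y (n + 1) - y n‖ + ‖u (n + 1) - u n‖

/-- The real value of `Ψ` at an iterate. -/
noncomputable def psiVal (A : E m →L[ℝ] E p) (F : E p → EReal) (G : E q → EReal)
    (H : E m × E q → ℝ) (β τ σ L : ℝ) (x : ℕ → E m) (y : ℕ → E q) (z u : ℕ → E p) (n : ℕ) : ℝ :=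
  (F (z (n + 1))).toReal + (G (y (n + 1))).toReal + smoothPart A H β τ (constC0 A β σ)
    (constC1 A β τ σ L) σ (x (n + 1)) (y (n + 1)) (z (n + 1)) (u (n + 1)) (x n) (u n)

namespace Setting

variable {A : E m →L[ℝ] E p} {F : E p → EReal} {G : E q → EReal} {H : E m × E q → ℝ}
  {μ β τ σ L : ℝ} {x : ℕ → E m} {y : ℕ → E q} {z u : ℕ → E p} {B₁ : Set (E m)} {B₂ : Set (E q)}
  (h : Setting A F G H μ β τ σ L x y z u B₁ B₂)

theorem stepLen_nonneg (n : ℕ) : 0 ≤ stepLen x y u n := by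
  unfold stepLen; positivity

include h

theorem y_min (n : ℕ) : IsMinOn
    (fun v => G v + (yModel (gradY H (x n) (y n)) μ (y n) v : EReal)) univ (y (n + 1)) :=
  h.gen.y_step n

theorem z_min (n : ℕ) : IsMinOn
    (fun w => F w + (zModel (u n) β (A (x n)) w : EReal)) univ (z (n + 1)) :=
  h.gen.z_step n

/-- The starting values `F (z 0)` and `G (y 0)` may be infinite. The shifted indexing uses only
points produced by a minimization, where both functions are finite. -/
theorem Psi_iterate (n : ℕ) : Psi A F G H β τ σ L (iterate x y z u n) =
    (psiVal A F G H β τ σ L x y z u n : EReal) := by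
  rw [iterate, Psi_rpoint, psiVal, EReal.coe_add, EReal.coe_add,
    ← exists_coe_of_isMinOn h.F_proper (h.z_min n), ← exists_coe_of_isMinOn h.G_proper (h.y_min n)]

theorem residual_eq (n : ℕ) : A (x (n + 1)) - z (n + 1) = (σ * β)⁻¹ • (u (n + 1) - u n) := by
  have := h.σ_pos
  have := h.β_pos
  rw [h.gen.u_step n, add_sub_cancel_left, smul_smul, inv_mul_cancel₀ (by positivity), one_smul]

theorem x_optimality (n : ℕ) : gradX H (x n) (y (n + 1)) + tr A (u n)
    + β • tr A (A (x n) - z (n + 1)) = -(τ • (x (n + 1) - x n)) := by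
  rw [h.gen.x_step n, sub_sub_cancel_left, smul_neg, neg_neg, smul_smul,
    mul_inv_cancel₀ h.τ_pos.ne', one_smul]

/-- The recursion for the regularizing vectors. -/
theorem regVec_succ (n : ℕ) :
    regVec A β τ σ (x (n + 2)) (x (n + 1)) (u (n + 2)) (u (n + 1)) =
      (1 - σ) • regVec A β τ σ (x (n + 1)) (x n) (u (n + 1)) (u n)
      + σ • (σ • opB A β τ (x (n + 1) - x n)
        - (gradX H (x (n + 1)) (y (n + 2)) - gradX H (x n) (y (n + 1)))) := by
  have h1 := regVec_step A h.τ_pos (h.gen.x_step n) (h.gen.u_step n)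
  have h2 := regVec_step A h.τ_pos (h.gen.x_step (n + 1)) (h.gen.u_step (n + 1))
  -- Eliminating `Aᵀ(u_{n+1} - u_n)` through the regularizing vector is what produces the weights `1
  -- - σ` and `σ`.
  have h3 : σ • opB A β τ (x (n + 1) - x n) =
      regVec A β τ σ (x (n + 1)) (x n) (u (n + 1)) (u n) - tr A (u (n + 1) - u n) := by
    rw [regVec, add_sub_cancel_left]
  rw [h2, h3, h1, map_sub]
  module

/-- The factor 2 on the left is deliberate: one half pays for the increase due to the dual update,
the other survives as the `C₄` term of the decrease. -/
theorem multiplier_le (n : ℕ) :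
    2 / (σ * β) * ‖u (n + 2) - u (n + 1)‖ ^ 2 ≤
      constC0 A β σ * (‖regVec A β τ σ (x (n + 1)) (x n) (u (n + 1)) (u n)‖ ^ 2
        - ‖regVec A β τ σ (x (n + 2)) (x (n + 1)) (u (n + 2)) (u (n + 1))‖ ^ 2)
      + constC1 A β τ σ L * ‖x (n + 1) - x n‖ ^ 2
      + 16 * L ^ 2 / (σ * β * lambdaMin A) * ‖y (n + 2) - y (n + 1)‖ ^ 2
      + 4 * σ * τ ^ 2 / (β * lambdaMin A) * ‖x (n + 2) - x (n + 1)‖ ^ 2 := by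
  have hσ := h.σ_pos
  have hB := norm_opB_le A h.β_pos h.τ_pos h.τβ
  refine multiplier_estimate (t := ‖tr A (u (n + 2) - u (n + 1))‖)
    (r := ‖σ • opB A β τ (x (n + 1) - x n)
        - (gradX H (x (n + 1)) (y (n + 2)) - gradX H (x n) (y (n + 1)))‖)
    h.β_pos h.σ_pos h.σ_le h.L_pos h.lam_pos (norm_nonneg _) (norm_nonneg _)
    (norm_nonneg _) (norm_nonneg _) ?_ ?_ ?_ (h.lam_le _)
  · rw [h.regVec_succ n]
    refine (norm_add_le _ _).trans (le_of_eq ?_)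
    rw [norm_smul, norm_smul, Real.norm_of_nonneg hσ.le,
      Real.norm_of_nonneg (sub_nonneg.2 h.σ_le)]
  · refine (norm_sub_le _ _).trans ?_
    rw [norm_smul, Real.norm_of_nonneg hσ.le]
    have h1 := h.lip.gradX_le h.L_pos (h.mem (n + 1)).1 (h.mem (n + 2)).2 (h.mem n).1
      (h.mem (n + 1)).2
    have h2 := mul_le_mul_of_nonneg_left (hB (x (n + 1) - x n)) hσ.le
    linarith
  · have h1 : tr A (u (n + 2) - u (n + 1)) =
        regVec A β τ σ (x (n + 2)) (x (n + 1)) (u (n + 2)) (u (n + 1))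
        - σ • opB A β τ (x (n + 2) - x (n + 1)) := by rw [regVec, add_sub_cancel_right]
    rw [h1]
    refine (norm_sub_le _ _).trans ?_
    rw [norm_smul, Real.norm_of_nonneg hσ.le]
    have h2 := mul_le_mul_of_nonneg_left (hB (x (n + 2) - x (n + 1))) hσ.le
    linarith

/-- The sufficient decrease of the regularized augmented Lagrangian. -/
theorem sufficient_decrease (n : ℕ) :
    psiVal A F G H β τ σ L x y z u (n + 1)
      + constC2 A β τ σ L * ‖x (n + 2) - x (n + 1)‖ ^ 2
      + constC3 A μ β σ L * ‖y (n + 2) - y (n + 1)‖ ^ 2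
      + constC4 β σ * ‖u (n + 2) - u (n + 1)‖ ^ 2 ≤ psiVal A F G H β τ σ L x y z u n := by
  have hF : (F (z (n + 2))).toReal + zModel (u (n + 1)) β (A (x (n + 1))) (z (n + 2)) ≤
      (F (z (n + 1))).toReal + zModel (u (n + 1)) β (A (x (n + 1))) (z (n + 1)) := by
    have h1 := le_sub_of_isMinOn (h.z_min (n + 1))
      (exists_coe_of_isMinOn h.F_proper (h.z_min (n + 1))) (z (n + 1))
    rw [exists_coe_of_isMinOn h.F_proper (h.z_min n), EReal.coe_le_coe_iff] at h1
    linarith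
  have hG : (G (y (n + 2))).toReal
      + yModel (gradY H (x (n + 1)) (y (n + 1))) μ (y (n + 1)) (y (n + 2)) ≤
      (G (y (n + 1))).toReal
      + yModel (gradY H (x (n + 1)) (y (n + 1))) μ (y (n + 1)) (y (n + 1)) := by
    have h1 := le_sub_of_isMinOn (h.y_min (n + 1))
      (exists_coe_of_isMinOn h.G_proper (h.y_min (n + 1))) (y (n + 1))
    rw [exists_coe_of_isMinOn h.G_proper (h.y_min n), EReal.coe_le_coe_iff] at h1
    linarith
  have hHy := h.lip.descent_y h.L_pos h.H_contDiff h.B₂_convex (h.mem (n + 1)).1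
    (h.mem (n + 1)).2 (h.mem (n + 2)).2
  have hHx := h.lip.descent_x h.L_pos h.H_contDiff h.B₁_convex (h.mem (n + 1)).1
    (h.mem (n + 2)).1 (h.mem (n + 2)).2
  have hxu := lagrangian_xu_step A h.β_pos h.τ_pos h.σ_pos (h.gen.x_step (n + 1))
    (h.gen.u_step (n + 1))
  have hm := h.multiplier_le n
  -- The descent inequalities hold with `L`; the constants `C₂` and `C₃` allow the weaker `L√2`.
  have hs2 : L ≤ L * √2 := le_mul_of_one_le_right h.L_pos.le (Real.one_le_sqrt.2 (by norm_num))
  have hLx := mul_le_mul_of_nonneg_right hs2 (sq_nonneg ‖x (n + 2) - x (n + 1)‖)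
  have hLy := mul_le_mul_of_nonneg_right hs2 (sq_nonneg ‖y (n + 2) - y (n + 1)‖)
  have hC2 : constC2 A β τ σ L = τ - (L * √2 + β * ‖A‖ ^ 2) / 2
      - 4 * σ * τ ^ 2 / (β * lambdaMin A) - constC1 A β τ σ L := rfl
  have h2 : 2 / (σ * β) * ‖u (n + 2) - u (n + 1)‖ ^ 2 =
    2 * (1 / (σ * β) * ‖u (n + 2) - u (n + 1)‖ ^ 2) := by ring
  rw [hC2, constC3, constC4]
  simp only [psiVal, smoothPart, zModel, yModel, add_assoc, Nat.reduceAdd, sub_self, norm_zero,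
    inner_sub_right] at *
  linarith

theorem exists_sufficient_decrease : ∃ c > 0, ∀ n,
    psiVal A F G H β τ σ L x y z u (n + 1) + c * stepLen x y u (n + 1) ^ 2 ≤
      psiVal A F G H β τ σ L x y z u n := by
  set c := min (constC2 A β τ σ L) (min (constC3 A μ β σ L) (constC4 β σ)) with hc
  have hc0 : 0 < c := h.C_pos
  refine ⟨c / 3, by positivity, fun n => ?_⟩
  have h1 := h.sufficient_decrease n
  have h2 := mul_le_mul_of_nonneg_right (min_le_left _ _ : c ≤ constC2 A β τ σ L)
    (sq_nonneg ‖x (n + 2) - x (n + 1)‖)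
  have h3 := mul_le_mul_of_nonneg_right
    ((min_le_right _ _).trans (min_le_left _ _) : c ≤ constC3 A μ β σ L)
    (sq_nonneg ‖y (n + 2) - y (n + 1)‖)
  have h4 := mul_le_mul_of_nonneg_right
    ((min_le_right _ _).trans (min_le_right _ _) : c ≤ constC4 β σ)
    (sq_nonneg ‖u (n + 2) - u (n + 1)‖)
  have h5 : ∀ a b d : ℝ, (a + b + d) ^ 2 ≤ 3 * (a ^ 2 + b ^ 2 + d ^ 2) := fun a b d => by
    nlinarith [sq_nonneg (a - b), sq_nonneg (a - d), sq_nonneg (b - d)]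
  have h6 := mul_le_mul_of_nonneg_left (h5 ‖x (n + 2) - x (n + 1)‖ ‖y (n + 2) - y (n + 1)‖
    ‖u (n + 2) - u (n + 1)‖) (by positivity : 0 ≤ c / 3)
  simp only [stepLen, add_assoc, Nat.reduceAdd] at *
  linarith

/-- Only the coupling term `⟪u, Ax - z⟫` has no lower bound of its own; boundedness of the sequence
controls it. -/
theorem exists_psiVal_lower_bound : ∃ M, ∀ n, M ≤ psiVal A F G H β τ σ L x y z u n := by
  obtain ⟨cF, hcF⟩ := h.F_bdd
  obtain ⟨cG, hcG⟩ := h.G_bdd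
  obtain ⟨cH, hcH⟩ := h.H_bdd
  obtain ⟨bx, hbx⟩ := h.x_bdd.exists_norm_le
  obtain ⟨bz, hbz⟩ := h.z_bdd.exists_norm_le
  obtain ⟨bu, hbu⟩ := h.u_bdd.exists_norm_le
  have hβ := h.β_pos
  have hσ := h.σ_pos
  have hlam := h.lam_pos
  have h1σ := sub_nonneg.2 h.σ_le
  have hC0 : 0 ≤ constC0 A β σ := by unfold constC0; positivity
  have hC1 : 0 ≤ constC1 A β τ σ L := by unfold constC1; positivity
  refine ⟨cF + cG + (cH - bu * (‖A‖ * bx + bz)), fun n => ?_⟩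
  have h1 : cF ≤ (F (z (n + 1))).toReal := by
    have := hcF (z (n + 1))
    rwa [exists_coe_of_isMinOn h.F_proper (h.z_min n), EReal.coe_le_coe_iff] at this
  have h2 : cG ≤ (G (y (n + 1))).toReal := by
    have := hcG (y (n + 1))
    rwa [exists_coe_of_isMinOn h.G_proper (h.y_min n), EReal.coe_le_coe_iff] at this
  have h3 : cH ≤ H (x (n + 1), y (n + 1)) := hcH ⟨_, rfl⟩
  have h4 : ‖A (x (n + 1)) - z (n + 1)‖ ≤ ‖A‖ * bx + bz :=
    (norm_sub_le _ _).trans (add_le_add ((A.le_opNorm _).trans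
      (mul_le_mul_of_nonneg_left (hbx _ ⟨_, rfl⟩) (norm_nonneg _))) (hbz _ ⟨_, rfl⟩))
  have h5 : -(bu * (‖A‖ * bx + bz)) ≤ inner ℝ (u (n + 1)) (A (x (n + 1)) - z (n + 1)) := by
    have h6 := (abs_le.1 (abs_real_inner_le_norm (u (n + 1)) (A (x (n + 1)) - z (n + 1)))).1
    have h7 : ‖u (n + 1)‖ ≤ bu := hbu _ ⟨_, rfl⟩
    have h8 := mul_le_mul h7 h4 (norm_nonneg _) ((norm_nonneg _).trans h7)
    linarith
  have h9 : 0 ≤ β / 2 * ‖A (x (n + 1)) - z (n + 1)‖ ^ 2 := by positivity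
  have h10 := mul_nonneg hC0
    (sq_nonneg ‖regVec A β τ σ (x (n + 1)) (x n) (u (n + 1)) (u n)‖)
  have h11 := mul_nonneg hC1 (sq_nonneg ‖x (n + 1) - x n‖)
  unfold psiVal smoothPart
  linarith

theorem exists_tendsto_psiVal : ∃ ψ, Tendsto (psiVal A F G H β τ σ L x y z u) atTop (𝓝 ψ) ∧
    ∀ n, ψ ≤ psiVal A F G H β τ σ L x y z u n := by
  obtain ⟨c, hc, hdec⟩ := h.exists_sufficient_decrease
  obtain ⟨M, hM⟩ := h.exists_psiVal_lower_bound
  have hanti : Antitone (psiVal A F G H β τ σ L x y z u) := antitone_nat_of_succ_le fun n => by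
    have := mul_nonneg hc.le (sq_nonneg (stepLen x y u (n + 1)))
    linarith [hdec n]
  have hbdd : BddBelow (range (psiVal A F G H β τ σ L x y z u)) := ⟨M, by rintro _ ⟨n, rfl⟩; exact hM n⟩
  exact ⟨_, tendsto_atTop_ciInf hanti hbdd, fun n => ciInf_le hbdd n⟩

theorem tendsto_stepLen : Tendsto (stepLen x y u) atTop (𝓝 0) := by
  obtain ⟨c, hc, hdec⟩ := h.exists_sufficient_decrease
  obtain ⟨ψ, hψ, -⟩ := h.exists_tendsto_psiVal
  rw [← tendsto_add_atTop_iff_nat 1]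
  have h1 : Tendsto (fun n => (psiVal A F G H β τ σ L x y z u n
      - psiVal A F G H β τ σ L x y z u (n + 1)) / c) atTop (𝓝 0) := by
    simpa using (hψ.sub (hψ.comp (tendsto_add_atTop_nat 1))).div_const c
  have h2 : Tendsto (fun n => stepLen x y u (n + 1) ^ 2) atTop (𝓝 0) :=
    squeeze_zero (fun _ => sq_nonneg _) (fun n => by
      rw [le_div_iff₀ hc]; linarith [hdec n]) h1
  simpa [Real.sqrt_sq, stepLen_nonneg] using h2.sqrt

theorem tendsto_sub_x : Tendsto (fun n => x (n + 1) - x n) atTop (𝓝 0) :=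
  squeeze_zero_norm (fun n => by
    unfold stepLen
    linarith [norm_nonneg (y (n + 1) - y n), norm_nonneg (u (n + 1) - u n)]) h.tendsto_stepLen

theorem tendsto_sub_y : Tendsto (fun n => y (n + 1) - y n) atTop (𝓝 0) :=
  squeeze_zero_norm (fun n => by
    unfold stepLen
    linarith [norm_nonneg (x (n + 1) - x n), norm_nonneg (u (n + 1) - u n)]) h.tendsto_stepLen

theorem tendsto_sub_u : Tendsto (fun n => u (n + 1) - u n) atTop (𝓝 0) :=
  squeeze_zero_norm (fun n => by
    unfold stepLen
    linarith [norm_nonneg (x (n + 1) - x n), norm_nonneg (y (n + 1) - y n)]) h.tendsto_stepLen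

end Setting

end FullSplitting

/-! ### Bounds by the step length -/

namespace FullSplitting

variable {m q p : ℕ}

namespace Setting

variable {A : E m →L[ℝ] E p} {F : E p → EReal} {G : E q → EReal} {H : E m × E q → ℝ}
  {μ β τ σ L : ℝ} {x : ℕ → E m} {y : ℕ → E q} {z u : ℕ → E p} {B₁ : Set (E m)} {B₂ : Set (E q)}

/-- Over the filter `⊤`, `=O` means a bound at every index with one constant, which is the form that
`summable_of_kl` asks for. -/
theorem isBigO_sub_x : (fun n => x (n + 1) - x n) =O[⊤] stepLen x y u :=
  isBigO_of_le _ fun n => by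
    rw [Real.norm_of_nonneg (stepLen_nonneg n), stepLen]
    linarith [norm_nonneg (y (n + 1) - y n), norm_nonneg (u (n + 1) - u n)]

theorem isBigO_sub_y : (fun n => y (n + 1) - y n) =O[⊤] stepLen x y u :=
  isBigO_of_le _ fun n => by
    rw [Real.norm_of_nonneg (stepLen_nonneg n), stepLen]
    linarith [norm_nonneg (x (n + 1) - x n), norm_nonneg (u (n + 1) - u n)]

theorem isBigO_sub_u : (fun n => u (n + 1) - u n) =O[⊤] stepLen x y u :=
  isBigO_of_le _ fun n => by
    rw [Real.norm_of_nonneg (stepLen_nonneg n), stepLen]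
    linarith [norm_nonneg (x (n + 1) - x n), norm_nonneg (y (n + 1) - y n)]

theorem isBigO_regVec :
    (fun n => regVec A β τ σ (x (n + 1)) (x n) (u (n + 1)) (u n)) =O[⊤] stepLen x y u :=
  (((tr A).isBigO_comp _ _).trans isBigO_sub_u).add
    ((((opB A β τ).isBigO_comp _ _).trans isBigO_sub_x).const_smul_left σ)

theorem isBigO_rpoint {a : ℕ → ℝ} {x x' : ℕ → E m} {y : ℕ → E q} {z u u' : ℕ → E p}
    (hx : x =O[⊤] a) (hy : y =O[⊤] a) (hz : z =O[⊤] a) (hu : u =O[⊤] a) (hx' : x' =O[⊤] a)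
    (hu' : u' =O[⊤] a) :
    (fun n => rpoint (x n) (y n) (z n) (u n) (x' n) (u' n)) =O[⊤] a :=
  (isBigO_of_le _ fun _ => (norm_rpoint_le _ _ _ _ _ _).trans (le_abs_self _)).trans
    (hx.norm_left.add (hy.norm_left.add (hz.norm_left.add (hu.norm_left.add
      (hx'.norm_left.add hu'.norm_left)))))

variable (h : Setting A F G H μ β τ σ L x y z u B₁ B₂)

include h

theorem isBigO_sub_gradX :
    (fun n => gradX H (x (n + 1)) (y (n + 1)) - gradX H (x n) (y (n + 1)))
      =O[⊤] stepLen x y u := by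
  refine IsBigO.trans (.of_bound L (Eventually.of_forall fun n => ?_)) isBigO_sub_x
  simpa using h.lip.gradX_le h.L_pos (h.mem (n + 1)).1 (h.mem (n + 1)).2 (h.mem n).1
    (h.mem (n + 1)).2

theorem isBigO_sub_gradY :
    (fun n => gradY H (x (n + 1)) (y (n + 1)) - gradY H (x n) (y n)) =O[⊤] stepLen x y u := by
  refine .of_bound L (Eventually.of_forall fun n => ?_)
  refine (h.lip.gradY_le h.L_pos (h.mem (n + 1)).1 (h.mem (n + 1)).2 (h.mem n).1
    (h.mem n).2).trans (mul_le_mul_of_nonneg_left ?_ h.L_pos.le)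
  rw [Real.norm_of_nonneg (stepLen_nonneg n), stepLen]
  linarith [norm_nonneg (u (n + 1) - u n)]

/-- Subgradients of `Ψ` at the iterates are controlled by the step lengths. -/
theorem exists_subgradient : ∃ d : ℕ → RSpace m q p, d =O[⊤] stepLen x y u ∧
    ∀ n, d n ∈ frechetSubdiff (Psi A F G H β τ σ L) (iterate x y z u n) := by
  have hx := isBigO_sub_x (x := x) (y := y) (u := u)
  have hy := isBigO_sub_y (x := x) (y := y) (u := u)
  have hu := isBigO_sub_u (x := x) (y := y) (u := u)
  have hw := isBigO_regVec (A := A) (β := β) (τ := τ) (σ := σ) (x := x) (y := y) (u := u)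
  have hAx := (A.isBigO_comp (fun n => x (n + 1) - x n) ⊤).trans hx
  have hAw := (A.isBigO_comp _ ⊤).trans hw
  have hBw := ((opB A β τ).isBigO_comp _ ⊤).trans hw
  have hx' := (hBw.const_smul_left (2 * constC0 A β σ * σ)).add
    (hx.const_smul_left (2 * constC1 A β τ σ L))
  refine ⟨_, isBigO_rpoint ?_ ?_ ?_ ?_ hx'.neg_left
    (hAw.const_smul_left (2 * constC0 A β σ)).neg_left,
    fun n => mem_frechetSubdiff_Psi h.F_proper h.G_proper h.H_contDiff (h.y_min n) (h.z_min n)⟩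
  -- Subtracting the optimality relation of the `x`-step leaves only differences of consecutive
  -- iterates in the `x`-block.
  · refine (((((h.isBigO_sub_gradX.add (((tr A).isBigO_comp _ ⊤).trans hu)).add
      ((((tr A).isBigO_comp _ ⊤).trans hAx).const_smul_left β)).sub (hx.const_smul_left τ)).add
      (hBw.const_smul_left (2 * constC0 A β σ * σ))).add
      (hx.const_smul_left (2 * constC1 A β τ σ L))).congr_left fun n => ?_
    have h1 := h.x_optimality n
    have h2 : gradX H (x n) (y (n + 1)) =
      -(τ • (x (n + 1) - x n)) - tr A (u n) - β • tr A (A (x n) - z (n + 1)) := by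
      rw [← h1]; abel
    simp only [h2, map_sub, Pi.smul_apply]
    module
  · refine (h.isBigO_sub_gradY.sub (hy.const_smul_left μ)).congr_left fun n => ?_
    rw [sub_sub, Pi.smul_apply]
  -- In the `z`-block, `z_{n+1}` cancels and `-(u_{n+1} - u_n) - βA(x_{n+1} - x_n)` remains.
  · refine (hu.neg_left.sub (hAx.const_smul_left β)).congr_left fun n => ?_
    simp only [map_sub, Pi.smul_apply]
    module
  · refine ((hu.const_smul_left (σ * β)⁻¹).add
      (hAw.const_smul_left (2 * constC0 A β σ))).congr_left fun n => ?_
    rw [h.residual_eq n]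
    rfl

omit h in
theorem isBigO_stepLen :
    stepLen x y u =O[⊤] fun n => stepLen x y u (n + 1) + stepLen x y u n :=
  isBigO_of_le _ fun n => by
    have h1 := stepLen_nonneg (x := x) (y := y) (u := u) n
    have h2 := stepLen_nonneg (x := x) (y := y) (u := u) (n + 1)
    rw [Real.norm_of_nonneg h1, Real.norm_of_nonneg (by positivity)]
    linarith

omit h in
theorem isBigO_stepLen_succ {V : Type*} [NormedAddCommGroup V] {f : ℕ → V}
    (hf : f =O[⊤] stepLen x y u) :
    (fun n => f (n + 1)) =O[⊤] fun n => stepLen x y u (n + 1) + stepLen x y u n :=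
  (hf.comp_tendsto (tendsto_top (f := fun n : ℕ => n + 1))).trans (isBigO_of_le _ fun n => by
    have h1 := stepLen_nonneg (x := x) (y := y) (u := u) n
    have h2 := stepLen_nonneg (x := x) (y := y) (u := u) (n + 1)
    rw [Function.comp_apply, Real.norm_of_nonneg h2, Real.norm_of_nonneg (by positivity)]
    linarith)

/-- The multiplier update determines `z_{n+1} = Ax_{n+1} - (σβ)⁻¹(u_{n+1} - u_n)`, so a `z`-step
involves two consecutive `u`-steps. This explains why `stepLen` omits `z` and why two step lengths
appear. -/
theorem isBigO_sub_z : (fun n => z (n + 2) - z (n + 1)) =O[⊤]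
    fun n => stepLen x y u (n + 1) + stepLen x y u n := by
  have hx := isBigO_stepLen_succ (isBigO_sub_x (x := x) (y := y) (u := u))
  have hu := isBigO_stepLen_succ (isBigO_sub_u (x := x) (y := y) (u := u))
  have hu' := (isBigO_sub_u (x := x) (y := y) (u := u)).trans isBigO_stepLen
  refine (((A.isBigO_comp _ ⊤).trans hx).sub ((hu.sub hu').const_smul_left (σ * β)⁻¹)).congr_left
    fun n => ?_
  rw [Pi.smul_apply, smul_sub, ← h.residual_eq n, ← h.residual_eq (n + 1), map_sub]
  abel

/-- The distance of consecutive iterates is controlled by two consecutive step lengths. -/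
theorem isBigO_sub_iterate : (fun n => iterate x y z u (n + 1) - iterate x y z u n) =O[⊤]
    fun n => stepLen x y u (n + 1) + stepLen x y u n :=
  isBigO_rpoint (isBigO_stepLen_succ isBigO_sub_x) (isBigO_stepLen_succ isBigO_sub_y)
    h.isBigO_sub_z (isBigO_stepLen_succ isBigO_sub_u) (isBigO_sub_x.trans isBigO_stepLen)
    (isBigO_sub_u.trans isBigO_stepLen)

/-! ### Cluster points -/

section Cluster

variable {s : ℕ → ℕ} {xs : E m} {ys : E q} {zs us : E p}
  (hs : Tendsto s atTop atTop)
  (hx : Tendsto (fun k => x (s k)) atTop (𝓝 xs)) (hy : Tendsto (fun k => y (s k)) atTop (𝓝 ys))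
  (hz : Tendsto (fun k => z (s k + 1)) atTop (𝓝 zs))
  (hu : Tendsto (fun k => u (s k)) atTop (𝓝 us))

omit h in
theorem tendsto_succ {V : Type*} [NormedAddCommGroup V] {f : ℕ → V} {s : ℕ → ℕ} {l : V}
    (hs : Tendsto s atTop atTop) (hf : Tendsto (fun n => f (n + 1) - f n) atTop (𝓝 0))
    (hl : Tendsto (fun k => f (s k)) atTop (𝓝 l)) :
    Tendsto (fun k => f (s k + 1)) atTop (𝓝 l) := by
  simpa using hl.add (hf.comp hs)

include hs hx hz

theorem cluster_feasible : zs = A xs := by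
  have h1 : Tendsto (fun k => A (x (s k + 1)) - z (s k + 1)) atTop (𝓝 (A xs - zs)) :=
    ((A.continuous.tendsto _).comp (tendsto_succ hs h.tendsto_sub_x hx)).sub hz
  have h2 : Tendsto (fun k => A (x (s k + 1)) - z (s k + 1)) atTop (𝓝 0) := by
    simp only [h.residual_eq]
    simpa using (h.tendsto_sub_u.comp hs).const_smul (σ * β)⁻¹
  exact (sub_eq_zero.1 (tendsto_nhds_unique h1 h2)).symm

include hy

omit hz in
-- Semicontinuity alone gives one inequality; the limit has to preserve the value of `G` because the
-- limiting subdifferential demands it.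
theorem cluster_G : G ys ≠ ⊤ ∧ Tendsto (fun k => G (y (s k + 1))) atTop (𝓝 (G ys)) := by
  have hg : Tendsto (fun k => gradY H (x (s k)) (y (s k))) atTop (𝓝 (gradY H xs ys)) :=
    tendsto_gradY h.H_contDiff hx hy
  have hy1 := tendsto_succ hs h.tendsto_sub_y hy
  refine tendsto_of_isMinOn (h := yModel (gradY H xs ys) μ ys) h.G_proper h.G_lsc
    (fun k => h.y_min (s k)) hy1 fun v => ?_
  unfold yModel
  exact ((hg.inner tendsto_const_nhds).add (((tendsto_const_nhds.sub hy).norm.pow 2).const_mul _)).sub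
    ((hg.inner hy1).add (((hy1.sub hy).norm.pow 2).const_mul _))

omit hy
include hu

omit hs in
theorem cluster_F : F zs ≠ ⊤ ∧ Tendsto (fun k => F (z (s k + 1))) atTop (𝓝 (F zs)) := by
  have hA : Tendsto (fun k => A (x (s k))) atTop (𝓝 (A xs)) := (A.continuous.tendsto _).comp hx
  refine tendsto_of_isMinOn (h := zModel us β (A xs)) h.F_proper h.F_lsc
    (fun k => h.z_min (s k)) hz fun v => ?_
  unfold zModel
  exact ((hu.inner (hA.sub tendsto_const_nhds)).add
    (((hA.sub tendsto_const_nhds).norm.pow 2).const_mul _)).sub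
    ((hu.inner (hA.sub hz)).add (((hA.sub hz).norm.pow 2).const_mul _))

include hy

theorem cluster_stat_x : -(tr A us) = gradX H xs ys := by
  have hy1 := tendsto_succ hs h.tendsto_sub_y hy
  have hg : Tendsto (fun k => gradX H (x (s k)) (y (s k + 1))) atTop (𝓝 (gradX H xs ys)) :=
    tendsto_gradX h.H_contDiff hx hy1
  have hA : Tendsto (fun k => A (x (s k)) - z (s k + 1)) atTop (𝓝 (A xs - zs)) :=
    ((A.continuous.tendsto _).comp hx).sub hz
  have hAu : Tendsto (fun k => tr A (u (s k))) atTop (𝓝 (tr A us)) :=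
    ((tr A).continuous.tendsto _).comp hu
  have hAA : Tendsto (fun k => tr A (A (x (s k)) - z (s k + 1))) atTop (𝓝 (tr A (A xs - zs))) :=
    ((tr A).continuous.tendsto _).comp hA
  have h1 := (hg.add hAu).add (hAA.const_smul β)
  have h2 : Tendsto (fun k => -(τ • (x (s k + 1) - x (s k)))) atTop (𝓝 (-(τ • 0))) :=
    ((h.tendsto_sub_x.comp hs).const_smul τ).neg
  simp only [← h.x_optimality] at h2
  have h3 := tendsto_nhds_unique h1 h2
  rw [h.cluster_feasible hs hx hz, sub_self, map_zero, smul_zero, add_zero, smul_zero,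
    neg_zero] at h3
  exact (eq_neg_of_add_eq_zero_left h3).symm

omit hz hu in
theorem cluster_stat_y : ∃ d ∈ limitingSubdiff G ys, 0 = d + gradY H xs ys := by
  have hg : Tendsto (fun k => gradY H (x (s k)) (y (s k))) atTop (𝓝 (gradY H xs ys)) :=
    tendsto_gradY h.H_contDiff hx hy
  obtain ⟨hfin, hG⟩ := h.cluster_G hs hx hy
  have hd : Tendsto (fun k => -(gradY H (x (s k)) (y (s k)) + μ • (y (s k + 1) - y (s k)))) atTop
      (𝓝 (-(gradY H xs ys + μ • 0))) :=
    (hg.add ((h.tendsto_sub_y.comp hs).const_smul μ)).neg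
  have hm : ∀ k, -(gradY H (x (s k)) (y (s k)) + μ • (y (s k + 1) - y (s k))) ∈
      frechetSubdiff G (y (s k + 1)) := fun k =>
    neg_mem_frechetSubdiff_of_isMinOn h.G_proper (h.y_min (s k))
      (yModel_hasFDerivAt (gradY H (x (s k)) (y (s k))) μ (y (s k)) (y (s k + 1)))
  rw [smul_zero, add_zero] at hd
  exact ⟨_, ⟨hfin, _, _, tendsto_succ hs h.tendsto_sub_y hy, hd, hG, hm⟩,
    (neg_add_cancel _).symm⟩

omit hy in
theorem cluster_stat_z : us ∈ limitingSubdiff F zs := by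
  obtain ⟨hfin, hF⟩ := h.cluster_F hx hz hu
  have hA : Tendsto (fun k => A (x (s k))) atTop (𝓝 (A xs)) := (A.continuous.tendsto _).comp hx
  have hd : Tendsto (fun k => u (s k) + β • (A (x (s k)) - z (s k + 1))) atTop
      (𝓝 (us + β • (A xs - zs))) :=
    hu.add ((hA.sub hz).const_smul β)
  rw [h.cluster_feasible hs hx hz, sub_self, smul_zero, add_zero] at hd
  have hm : ∀ k, - -(u (s k) + β • (A (x (s k)) - z (s k + 1))) ∈
      frechetSubdiff F (z (s k + 1)) := fun k =>
    neg_mem_frechetSubdiff_of_isMinOn h.F_proper (h.z_min (s k))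
      (zModel_hasFDerivAt (u (s k)) β (A (x (s k))) (z (s k + 1)))
  simp only [neg_neg] at hm
  exact ⟨hfin, _, _, hz, hd, hF, hm⟩

/-- Cluster points of the sequence are KKT points. -/
theorem cluster_isKKT : IsKKT A F G H xs ys zs us where
  feasible := h.cluster_feasible hs hx hz
  stat_x := h.cluster_stat_x hs hx hy hz hu
  stat_y := h.cluster_stat_y hs hx hy
  stat_z := h.cluster_stat_z hs hx hz hu

theorem cluster_iterate : Tendsto (fun k => iterate x y z u (s k)) atTop
    (𝓝 (rpoint xs ys zs us xs us)) :=
  tendsto_rpoint (tendsto_succ hs h.tendsto_sub_x hx) (tendsto_succ hs h.tendsto_sub_y hy) hz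
    (tendsto_succ hs h.tendsto_sub_u hu) hx hu

/-- `Ψ` is continuous along subsequences of iterates. -/
theorem cluster_Psi : Psi A F G H β τ σ L (rpoint xs ys zs us xs us) ≠ ⊤ ∧
    Tendsto (fun k => Psi A F G H β τ σ L (iterate x y z u (s k))) atTop
      (𝓝 (Psi A F G H β τ σ L (rpoint xs ys zs us xs us))) := by
  obtain ⟨hFfin, hF⟩ := h.cluster_F hx hz hu
  obtain ⟨hGfin, hG⟩ := h.cluster_G hs hx hy
  have hS := ((continuous_smoothPart A h.H_contDiff.continuous β τ (constC0 A β σ)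
    (constC1 A β τ σ L) σ).tendsto (xs, ys, zs, us, xs, us)).comp
    ((tendsto_succ hs h.tendsto_sub_x hx).prodMk_nhds
      ((tendsto_succ hs h.tendsto_sub_y hy).prodMk_nhds (hz.prodMk_nhds
        ((tendsto_succ hs h.tendsto_sub_u hu).prodMk_nhds (hx.prodMk_nhds hu)))))
  have hS' := (continuous_coe_real_ereal.tendsto _).comp hS
  have hFG : F zs + G ys ≠ ⊤ := (EReal.add_lt_top hFfin hGfin).ne
  have hFG' : F zs + G ys ≠ ⊥ := by
    rw [Ne, EReal.add_eq_bot_iff, not_or]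
    exact ⟨h.F_proper.1 _, h.G_proper.1 _⟩
  refine ⟨(EReal.add_lt_top hFG (EReal.coe_ne_top _)).ne, ?_⟩
  have h1 : Tendsto (fun k => F (z (s k + 1)) + G (y (s k + 1))) atTop (𝓝 (F zs + G ys)) :=
    (EReal.continuousAt_add (p := (F zs, G ys)) (.inl hFfin) (.inr hGfin)).tendsto.comp
      (hF.prodMk_nhds hG)
  exact (EReal.continuousAt_add (p := (F zs + G ys, _)) (.inl hFG) (.inl hFG')).tendsto.comp
      (h1.prodMk_nhds hS')

/-- The Kurdyka–Łojasiewicz property is assumed only where `∂Ψ` is nonempty; vanishing subgradients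
along the subsequence supply an element. -/
theorem cluster_zero_mem :
    (0 : RSpace m q p) ∈ limitingSubdiff (Psi A F G H β τ σ L) (rpoint xs ys zs us xs us) := by
  obtain ⟨hfin, hΨ⟩ := h.cluster_Psi hs hx hy hz hu
  obtain ⟨d, hd, hmem⟩ := h.exists_subgradient
  have hd0 : Tendsto d atTop (𝓝 0) := (hd.mono le_top).trans_tendsto h.tendsto_stepLen
  exact ⟨hfin, _, fun k => d (s k), h.cluster_iterate hs hx hy hz hu, hd0.comp hs, hΨ,
    fun k => hmem (s k)⟩

end Cluster

/-- `z` is taken one index later than the other variables because `z_{n+1}` is the iterate that the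
steps couple to `x_n` and `u_n`. -/
theorem exists_cluster : ∃ (s : ℕ → ℕ) (xs : E m) (ys : E q) (zs us : E p), StrictMono s ∧
    Tendsto (fun k => x (s k)) atTop (𝓝 xs) ∧ Tendsto (fun k => y (s k)) atTop (𝓝 ys) ∧
    Tendsto (fun k => z (s k + 1)) atTop (𝓝 zs) ∧ Tendsto (fun k => u (s k)) atTop (𝓝 us) := by
  obtain ⟨⟨xs, ys, zs, us⟩, -, s, hs, hlim⟩ := tendsto_subseq_of_bounded
    (h.x_bdd.prod (h.y_bdd.prod (h.z_bdd.prod h.u_bdd)))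
    (x := fun n => (x n, y n, z (n + 1), u n)) fun n => ⟨⟨n, rfl⟩, ⟨n, rfl⟩, ⟨n + 1, rfl⟩, ⟨n, rfl⟩⟩
  exact ⟨s, xs, ys, zs, us, hs, hlim.fst_nhds, hlim.snd_nhds.fst_nhds,
    hlim.snd_nhds.snd_nhds.fst_nhds, hlim.snd_nhds.snd_nhds.snd_nhds⟩

/-! ### Finite length and convergence -/

/-- The step lengths are summable if `Ψ` is a KŁ function. -/
theorem summable_stepLen (hKL : IsKLFunction (Psi A F G H β τ σ L)) : Summable (stepLen x y u) := by
  obtain ⟨s, xs, ys, zs, us, hs, hx, hy, hz, hu⟩ := h.exists_cluster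
  have hs' := hs.tendsto_atTop
  obtain ⟨η, hη, U, hU, φ, hφ, hineq⟩ := hKL _ ⟨0, h.cluster_zero_mem hs' hx hy hz hu⟩
  obtain ⟨c, hc, hdec⟩ := h.exists_sufficient_decrease
  obtain ⟨ψ, hψ, hψle⟩ := h.exists_tendsto_psiVal
  obtain ⟨d, hd, hmem⟩ := h.exists_subgradient
  obtain ⟨C, hC, hdC⟩ := hd.exists_nonneg
  obtain ⟨D, hD, hXD⟩ := h.isBigO_sub_iterate.exists_nonneg
  rw [isBigOWith_top] at hdC hXD
  -- The limit of the decreasing values equals `Ψ` at the cluster point, so the gaps `psiVal n - ψ`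
  -- are exactly the arguments of `φ'` in the inequality.
  have hw : Psi A F G H β τ σ L (rpoint xs ys zs us xs us) = (ψ : EReal) := by
    refine tendsto_nhds_unique (h.cluster_Psi hs' hx hy hz hu).2 ?_
    simp only [h.Psi_iterate]
    exact (continuous_coe_real_ereal.tendsto _).comp (hψ.comp hs')
  refine summable_of_kl (X := iterate x y z u) (l := fun n => psiVal A F G H β τ σ L x y z u n - ψ)
    hc hC hD stepLen_nonneg h.tendsto_stepLen (fun n => sub_nonneg.2 (hψle n))
    (by simpa using hψ.sub_const ψ) (fun n => by linarith [hdec n]) (fun n => ?_)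
    ⟨s, hs, h.cluster_iterate hs' hx hy hz hu⟩ hη hU hφ fun n hn hl hlη => ?_
  · have h1 := hXD n
    rwa [Real.norm_of_nonneg (add_nonneg (stepLen_nonneg _) (stepLen_nonneg _))] at h1
  have h1 := hineq _ hn
  rw [hw, h.Psi_iterate, EReal.toReal_coe, EReal.toReal_coe] at h1
  have h2 := h1 (by exact_mod_cast sub_pos.1 hl) (by
    have := EReal.add_lt_add_left_coe hlη ψ
    rwa [← EReal.coe_add, add_sub_cancel] at this)
  have hD' := hφ.deriv_pos _ hl hlη
  have h3 : Metric.infEDist (0 : RSpace m q p)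
      (limitingSubdiff (Psi A F G H β τ σ L) (iterate x y z u n)) ≤ ENNReal.ofReal ‖d n‖ :=
    (Metric.infEDist_le_edist_of_mem (frechetSubdiff_subset_limitingSubdiff _ _ (hmem n))).trans
      (by rw [edist_dist, dist_zero_left])
  have h4 := h2.trans (mul_le_mul_right h3 _)
  rw [← ENNReal.ofReal_mul hD'.le, ENNReal.one_le_ofReal] at h4
  refine h4.trans (mul_le_mul_of_nonneg_left ?_ hD'.le)
  simpa [Real.norm_of_nonneg (stepLen_nonneg n)] using hdC n

end Setting

end FullSplitting

theorem mainTheorem1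
    {m q p : ℕ} (hm : 0 < m) (hq : 0 < q) (hp : 0 < p)
    (A : E m →L[ℝ] E p) (F : E p → EReal) (G : E q → EReal) (H : E m × E q → ℝ)
    (hFproper : IsProper F) (hFlsc : LowerSemicontinuous F)
    (hGproper : IsProper G) (hGlsc : LowerSemicontinuous G)
    (hH : ContDiff ℝ 1 H)
    (hFbdd : IsBoundedBelow F) (hGbdd : IsBoundedBelow G) (hHbdd : BddBelow (Set.range H))
    (hA : Function.Surjective A)
    (μ β τ σ L : ℝ) (hμ : 0 < μ) (hβ : 0 < β) (hτ : 0 < τ) (hσ : 0 < σ) (hσ1 : σ ≤ 1)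
    (hL : 0 < L)
    (hτβ : β * ‖A‖ ^ 2 ≤ 2 * τ)
    (hC : 0 < min (constC2 A β τ σ L) (min (constC3 A μ β σ L) (constC4 β σ)))
    (x : ℕ → E m) (y : ℕ → E q) (z u : ℕ → E p)
    (hgen : IsGenerated A F G H μ β τ σ x y z u)
    (hxbdd : Bornology.IsBounded (Set.range x)) (hybdd : Bornology.IsBounded (Set.range y))
    (hzbdd : Bornology.IsBounded (Set.range z)) (hubdd : Bornology.IsBounded (Set.range u))
    (B₁ : Set (E m)) (B₂ : Set (E q))
    (hB₁ : Convex ℝ B₁) (hB₁bdd : Bornology.IsBounded B₁)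
    (hB₂ : Convex ℝ B₂) (hB₂bdd : Bornology.IsBounded B₂)
    (hmem : ∀ n, x n ∈ B₁ ∧ y n ∈ B₂)
    (hLip : GradLipschitzOn H L B₁ B₂)
    (hKL : IsKLFunction (Psi A F G H β τ σ L)) :
    (Summable (fun n => ‖x (n + 1) - x n‖) ∧ Summable (fun n => ‖y (n + 1) - y n‖) ∧
      Summable (fun n => ‖z (n + 1) - z n‖) ∧ Summable (fun n => ‖u (n + 1) - u n‖)) ∧
    ∃ (xs : E m) (ys : E q) (zs us : E p),
      Tendsto x atTop (𝓝 xs) ∧ Tendsto y atTop (𝓝 ys) ∧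
      Tendsto z atTop (𝓝 zs) ∧ Tendsto u atTop (𝓝 us) ∧
      IsKKT A F G H xs ys zs us := by
  obtain ⟨hlam, hle⟩ := lambdaMin_spec hp A hA
  have h : Setting A F G H μ β τ σ L x y z u B₁ B₂ :=
    ⟨hlam, hle, hFproper, hFlsc, hGproper, hGlsc, hH, hFbdd, hGbdd, hHbdd, hβ, hτ, hσ, hσ1, hL,
      hτβ, hC, hgen, hxbdd, hybdd, hzbdd, hubdd, hB₁, hB₂, hmem, hLip⟩
  have hS := h.summable_stepLen hKL
  have hS' : Summable fun n => stepLen x y u (n + 1) + stepLen x y u n :=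
    ((summable_nat_add_iff 1).2 hS).add hS
  have hsx : Summable fun n => ‖x (n + 1) - x n‖ :=
    (summable_of_isBigO_nat hS (Setting.isBigO_sub_x.norm_left.mono le_top))
  have hsy : Summable fun n => ‖y (n + 1) - y n‖ :=
    (summable_of_isBigO_nat hS (Setting.isBigO_sub_y.norm_left.mono le_top))
  have hsu : Summable fun n => ‖u (n + 1) - u n‖ :=
    (summable_of_isBigO_nat hS (Setting.isBigO_sub_u.norm_left.mono le_top))
  have hsz : Summable fun n => ‖z (n + 1) - z n‖ :=
    (summable_nat_add_iff 1).1 (summable_of_isBigO_nat hS' (h.isBigO_sub_z.norm_left.mono le_top))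
  have key : ∀ {V : Type} [NormedAddCommGroup V] [CompleteSpace V] (f : ℕ → V),
      (Summable fun n => ‖f (n + 1) - f n‖) → ∃ l, Tendsto f atTop (𝓝 l) := fun f hf =>
    cauchySeq_tendsto_of_complete (cauchySeq_of_summable_dist
      (by simpa only [dist_eq_norm, norm_sub_rev] using hf))
  obtain ⟨xs, hx⟩ := key x hsx
  obtain ⟨ys, hy⟩ := key y hsy
  obtain ⟨zs, hz⟩ := key z hsz
  obtain ⟨us, hu⟩ := key u hsu
  -- With the whole sequence convergent, the cluster-point result applies to the identity
  -- subsequence.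
  exact ⟨⟨hsx, hsy, hsz, hsu⟩, xs, ys, zs, us, hx, hy, hz, hu,
    h.cluster_isKKT tendsto_id hx hy (hz.comp (tendsto_add_atTop_nat 1)) hu⟩
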